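/- **Setting.** For $f,g:\mathbb R^p\times\mathbb R^q\to\mathbb R$ with $g(x,\cdot)$ strongly convex put $y^*(x)=\arg\min_y g(x,y)$ and $\Phi(x)=f(x,y^*(x))$. Given constants $L_x,L_{xy},L_y,\widetilde L_{xy},\widetilde L_y,\rho_{xy},\rho_{yy},\mu_x,\mu_y,B$, the class $\mathcal F_{scsc}$ consists of the pairs $(f,g)$, $f$ of class $C^1$ and $g$ of class $C^2$, such that - $\nabla_x f$ is $L_x$-Lipschitz in $x$ and $L_{xy}$-Lipschitz in $y$; $\nabla_y f$ is $L_{xy}$-Lipschitz in $x$ and $L_y$-Lipschitz in $y$; $\nabla_y g$ is $\widetilde L_{xy}$-Lipschitz in $x$ and $\widetilde L_y$-Lipschitz in $y$; - $\nabla_x\nabla_y g$ and $\nabla_y^2 g$ are $\rho_{xy}$- and $\rho_{yy}$-Lipschitz in $(x,y)$; - $g(x,\cdot)$ is $\mu_y$-strongly convex for every $x$, $\Phi$ is $\mu_x$-strongly convex, and its minimiser $x^*$ has norm $\|x^*\|=B$. **Algorithm class.** An algorithm runs $K$ iterations and updates $x$ at $Q$ of them, $s_0<\dots<s_{Q-1}\le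 K$; it has a parameter $T\in\mathbb N$. Its iterates satisfy $x^k\in\mathcal H_x^k$, $y^k\in\mathcal H_y^k$, where $\mathcal H_x^0=\mathcal H_y^0=\{0\}$ (so $x_0=0$), $$\mathcal H_y^{k+1}=\mathrm{Span}\{y_i,\ \nabla_y g(\tilde x_i,\tilde y_i)\ :\ 0\le i\le k\},$$ $$\mathcal H_x^{s_m}=\mathrm{Span}\Big\{x_i,\ \nabla_x f(\tilde x_i,\tilde y_i),\ \nabla_x\nabla_y g(x_i^t,y_i^t)\prod_{j=1}^t\big(I-\alpha\nabla_y^2 g(x_{i,j}^t,y_{i,j}^t)\big)\nabla_y f(\hat x_i,\hat y_i)\ :\ 0\le i\le s_m-1,\ 0\le t\le T,\ \alpha\in\mathbb R\Big\}$$ for $s_m\ge 1$; here all $x$-points with index $i$ range over $\mathcal H_x^i$ and all $y$-points with index $i$ over $\mathcal H_y^i$; and $\mathcal H_x^n=\mathcal H_x^{n-1}$ if $x$ is not updated at iteration $n\ge1$. The output is any $x^K\in\mathcal H_x^K$. Put $M=K+QT+Q+2$. The complexity is $\mathcal C=\tau(n_J+n_H)+n_G$, where $\tau>0$ is a universal constant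 and the numbers of Jacobian-vector products, Hessian-vector products and gradient evaluations are counted as $n_J=Q$, $n_H=QT$, $n_G=K$. **Theorem.** Let $L_x,L_y,\widetilde L_{xy},\widetilde L_y,\tau>0$ and $L_{xy}\in\mathbb R$. There are constants $c_1,\dots,c_5>0$, depending only on these six numbers, such that for all $0<\mu_x\le L_x$ and $0<\mu_y\le\widetilde L_y$ with $L_{xy}\ge\frac{(L_x-\mu_x)(\widetilde L_y-\mu_y)}{2\widetilde L_{xy}}$ there are reals $r,\xi$ with $$\xi\ \ge\ \frac{\widetilde L_y}{4\mu_y}+\frac{L_x}{8\mu_x}+\frac{L_y\widetilde L_{xy}^2}{8\mu_x\mu_y^2}-\frac38\ \ge\ \frac{c_1}{\mu_x\mu_y^2},\qquad 1-\Big(\tfrac12+\sqrt{\xi+\tfrac14}\Big)^{-1}<r<1,$$ such that the following holds for all $\rho_{xy},\rho_{yy}\ge0$ and $B>0$. There is a function $D:\mathbb R\to\mathbb N$ such that for every $d\ge5$ there is an instance $(f,g)\in\mathcal F_{scsc}$ with $p=q=d$, where $$f(x,y)=\tfrac12x^TAx+x^TCy+\tfrac12y^TEy+u^Tx+v^Ty,\qquad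 g(x,y)=\tfrac12y^THy+x^TJy+b^Ty,$$ $u,v,b\in\mathbb R^d$, and the matrices $A,C,E,H,J$ are polynomials in the $d\times d$ coupling matrix $Z$ with $Z_{ij}=1$ if $i+j=d+1$, $Z_{ij}=-1$ if $i+j=d+2$, and $Z_{ij}=0$ otherwise ($1\le i,j\le d$), with the following two properties. 1. For every algorithm of the class with $d>\max\{2M,\ M+1+\log_r(c_2\mu_x\mu_y^2)\}$ and every output $x^K$ of it, $$\Phi(x^K)-\Phi(x^*)\ \ge\ c_3\,\mu_x\mu_y^2\,(\Phi(x_0)-\Phi(x^*))\,r^{2M}.$$ 2. For every $\varepsilon$ with $0<\varepsilon\le c_4\,\mu_x\mu_y^2(\Phi(x_0)-\Phi(x^*))$ and $d\ge D(\varepsilon)$, every algorithm of the class with an output satisfying $\Phi(x^K)-\Phi(x^*)\le\varepsilon$ has complexity $$\mathcal C\ \ge\ c_5\sqrt{\frac{L_y\widetilde L_{xy}^2}{\mu_x\mu_y^2}}\ \log\frac{\mu_x\mu_y^2(\Phi(x_0)-\Phi(x^*))}{\varepsilon}.$$ -/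

import Mathlib

/-- The inner solution `argmin_y g(x, y)`: a minimiser of `g x`, the unique one when
`g x` is strongly convex and continuous on a finite-dimensional space. -/
noncomputable def innerArgmin {X Y : Type*} [NormedAddCommGroup Y]
    (g : X → Y → ℝ) (x : X) : Y :=
  Classical.epsilon fun y => IsMinOn (g x) Set.univ y

/-- The total objective `Φ(x) = f(x, y*(x))`, `y*(x) = argmin_y g(x, y)`. -/
noncomputable def totalObjective {X Y : Type*} [NormedAddCommGroup Y]
    (f g : X → Y → ℝ) (x : X) : ℝ :=
  f x (innerArgmin g x)

section Derivatives

variable {X Y : Type*}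
  [NormedAddCommGroup X] [InnerProductSpace ℝ X] [CompleteSpace X]
  [NormedAddCommGroup Y] [InnerProductSpace ℝ Y] [CompleteSpace Y]

/-- `∇_x h(x, y)`. -/
noncomputable def gradX (h : X → Y → ℝ) (x : X) (y : Y) : X :=
  gradient (fun x' => h x' y) x

/-- `∇_y h(x, y)`. -/
noncomputable def gradY (h : X → Y → ℝ) (x : X) (y : Y) : Y :=
  gradient (fun y' => h x y') y

/-- The `p × q` matrix `∇_x ∇_y h(x, y)` of mixed second derivatives, as a linear map from the
`y`-space to the `x`-space, `v ↦ ∂_y (∇_x h)(x, y) v`. -/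
noncomputable def jacXY (h : X → Y → ℝ) (x : X) (y : Y) : Y →L[ℝ] X :=
  fderiv ℝ (fun y' => gradX h x y') y

/-- The Hessian `∇_y² h(x, y)`. -/
noncomputable def hessY (h : X → Y → ℝ) (x : X) (y : Y) : Y →L[ℝ] Y :=
  fderiv ℝ (fun y' => gradY h x y') y

/-- The strongly-convex–strongly-convex class of bilevel problems, with smoothness constants
`Lx, Lxy, Ly` of `f`, `Lgxy, Lgy` of `g`, Lipschitz constants `ρxy, ρyy` of the second derivatives
of `g`, strong convexity constants `μx` of `Φ` and `μy` of `g(x, ·)`, and norm `B` of the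
minimiser of `Φ`. -/
structure SCSCClass (Lx Lxy Ly Lgxy Lgy ρxy ρyy μx μy B : ℝ) (f g : X → Y → ℝ) : Prop where
  contDiff_f : ContDiff ℝ 1 fun z : X × Y => f z.1 z.2
  contDiff_g : ContDiff ℝ 2 fun z : X × Y => g z.1 z.2
  gradX_f_x : ∀ x₁ x₂ y, ‖gradX f x₁ y - gradX f x₂ y‖ ≤ Lx * ‖x₁ - x₂‖
  gradX_f_y : ∀ x y₁ y₂, ‖gradX f x y₁ - gradX f x y₂‖ ≤ Lxy * ‖y₁ - y₂‖
  gradY_f_x : ∀ x₁ x₂ y, ‖gradY f x₁ y - gradY f x₂ y‖ ≤ Lxy * ‖x₁ - x₂‖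
  gradY_f_y : ∀ x y₁ y₂, ‖gradY f x y₁ - gradY f x y₂‖ ≤ Ly * ‖y₁ - y₂‖
  gradY_g_x : ∀ x₁ x₂ y, ‖gradY g x₁ y - gradY g x₂ y‖ ≤ Lgxy * ‖x₁ - x₂‖
  gradY_g_y : ∀ x y₁ y₂, ‖gradY g x y₁ - gradY g x y₂‖ ≤ Lgy * ‖y₁ - y₂‖
  jacXY_g : ∀ x₁ x₂ y₁ y₂, ‖jacXY g x₁ y₁ - jacXY g x₂ y₂‖ ≤
    ρxy * Real.sqrt (‖x₁ - x₂‖ ^ 2 + ‖y₁ - y₂‖ ^ 2)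
  hessY_g : ∀ x₁ x₂ y₁ y₂, ‖hessY g x₁ y₁ - hessY g x₂ y₂‖ ≤
    ρyy * Real.sqrt (‖x₁ - x₂‖ ^ 2 + ‖y₁ - y₂‖ ^ 2)
  strongConvex_g : ∀ x, StrongConvexOn Set.univ μy (g x)
  strongConvex_total : StrongConvexOn Set.univ μx (totalObjective f g)
  exists_minimiser : ∃ x, IsMinOn (totalObjective f g) Set.univ x ∧ ‖x‖ = B

/-- The directions contributed to the `y`-search space by points of given search spaces. -/
def yGenerators (g : X → Y → ℝ) (Hx : Submodule ℝ X) (Hy : Submodule ℝ Y) : Set Y :=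
  {v | v ∈ Hy ∨ ∃ x ∈ Hx, ∃ y ∈ Hy, v = gradY g x y}

/-- The directions contributed to the `x`-search space by points of given search spaces:
the points themselves, the gradients `∇_x f`, and the products
`∇_x∇_y g · ∏_{j=1}^t (I - α ∇_y² g) · ∇_y f`, `0 ≤ t ≤ T`, `α` real, where all the derivatives
are evaluated at arbitrary, possibly different points of the search spaces. -/
def xGenerators (f g : X → Y → ℝ) (T : ℕ) (Hx : Submodule ℝ X) (Hy : Submodule ℝ Y) : Set X :=
  {v | v ∈ Hx ∨ (∃ x ∈ Hx, ∃ y ∈ Hy, v = gradX f x y) ∨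
    ∃ (t : ℕ) (α : ℝ) (a c : X × Y) (z : Fin t → X × Y), t ≤ T ∧
      (a.1 ∈ Hx ∧ a.2 ∈ Hy) ∧ (c.1 ∈ Hx ∧ c.2 ∈ Hy) ∧ (∀ j, (z j).1 ∈ Hx ∧ (z j).2 ∈ Hy) ∧
      v = jacXY g a.1 a.2
        ((List.ofFn fun j => (1 : Y →L[ℝ] Y) - α • hessY g (z j).1 (z j).2).prod
          (gradY f c.1 c.2))}

open scoped Classical in
/-- The search spaces `(H_x^k, H_y^k)`, where `upd` is the set of the iterations at which `x` is
updated: both are `{0}` at `k = 0`, `H_y^{k+1}` is spanned by the directions contributed by the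
search spaces with indices `0, …, k`, and so is `H_x^{k+1}` if `x` is updated at iteration `k + 1`;
otherwise `H_x^{k+1} = H_x^k`. -/
noncomputable def searchSpaces (f g : X → Y → ℝ) (T : ℕ) (upd : Set ℕ) :
    ℕ → Submodule ℝ X × Submodule ℝ Y
  | 0 => (⊥, ⊥)
  | k + 1 =>
    (if k + 1 ∈ upd then
        Submodule.span ℝ (⋃ i : Fin (k + 1),
          xGenerators f g T (searchSpaces f g T upd i).1 (searchSpaces f g T upd i).2)
      else (searchSpaces f g T upd k).1,
      Submodule.span ℝ (⋃ i : Fin (k + 1),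
        yGenerators g (searchSpaces f g T upd i).1 (searchSpaces f g T upd i).2))
  termination_by n => n
  decreasing_by all_goals first | exact i.2 | omega

end Derivatives

/-- The parameters of an algorithm of the hypergradient-based class: `K` iterations, `x` is updated
`Q` times, at the iterations `s 0 < s 1 < … ≤ K`, and every hypergradient estimate uses at most `T`
Hessian-vector products. -/
structure AlgorithmSchedule where
  K : ℕ
  T : ℕ
  Q : ℕ
  s : Fin Q → ℕ
  strictMono_s : StrictMono s
  s_le : ∀ i, s i ≤ K

namespace AlgorithmSchedule

/-- `M = K + QT + Q + 2`. -/
def M (S : AlgorithmSchedule) : ℕ := S.K + S.Q * S.T + S.Q + 2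

/-- The complexity `τ (n_J + n_H) + n_G` with `n_J = Q` Jacobian-vector products, `n_H = QT`
Hessian-vector products and `n_G = K` gradient evaluations. -/
def complexity (S : AlgorithmSchedule) (τ : ℝ) : ℝ :=
  τ * ((S.Q : ℝ) + (S.Q : ℝ) * (S.T : ℝ)) + (S.K : ℝ)

/-- The subspace `H_x^K` that contains the output `x^K`. -/
noncomputable def outputSpace {X Y : Type*}
    [NormedAddCommGroup X] [InnerProductSpace ℝ X] [CompleteSpace X]
    [NormedAddCommGroup Y] [InnerProductSpace ℝ Y] [CompleteSpace Y]
    (S : AlgorithmSchedule) (f g : X → Y → ℝ) : Submodule ℝ X :=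
  (searchSpaces f g S.T (Set.range S.s) S.K).1

end AlgorithmSchedule

/-- The coupling matrix: `1` on the antidiagonal, `-1` directly below it, `0` elsewhere. -/
def couplingMatrix (d : ℕ) : Matrix (Fin d) (Fin d) ℝ :=
  Matrix.of fun i j =>
    if (i : ℕ) + j + 1 = d then 1 else if (i : ℕ) + j = d then -1 else 0

/-- The operator `p(Z)` on `ℝ^d`, for a polynomial `p` and the coupling matrix `Z`. -/
noncomputable def couplingOp (d : ℕ) (p : Polynomial ℝ) :
    EuclideanSpace ℝ (Fin d) →ₗ[ℝ] EuclideanSpace ℝ (Fin d) :=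
  Matrix.toEuclideanLin (Polynomial.aeval (couplingMatrix d) p)

/-- `f` and `g` are quadratic functions,
`f(x,y) = ½ xᵀA x + xᵀC y + ½ yᵀE y + uᵀx + vᵀy` and `g(x,y) = ½ yᵀH y + xᵀJ y + bᵀy`,
whose matrices `A, C, E, H, J` are polynomials in the coupling matrix. -/
def IsCoupledQuadratic {d : ℕ}
    (f g : EuclideanSpace ℝ (Fin d) → EuclideanSpace ℝ (Fin d) → ℝ) : Prop :=
  ∃ (A C E H J : Polynomial ℝ) (u v b : EuclideanSpace ℝ (Fin d)),
    (∀ x y, f x y = 1 / 2 * inner ℝ x (couplingOp d A x) + inner ℝ x (couplingOp d C y)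
      + 1 / 2 * inner ℝ y (couplingOp d E y) + inner ℝ u x + inner ℝ v y) ∧
    (∀ x y, g x y = 1 / 2 * inner ℝ y (couplingOp d H y) + inner ℝ x (couplingOp d J y)
      + inner ℝ b y)

/-! Both levels of the hard instance are quadratic, with operators that are polynomials in the
coupling matrix `Z`, a self-adjoint matrix of norm at most `2`. If `K = (β Z² + μy)⁻¹` is the
inverse Hessian of the lower level, the Hessian of the total objective is `K² (q Z⁴ + l Z² + c)`
with `c = μx μy²`, and the quartic factors as `(q Z² + k) (Z² + s)`. Since `Z²` is a second
difference operator, the solution of `(Z² + s) x = ω e₁` decays like `r ^ i`, where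
`(1 - r)² = s r`, and the linear terms are chosen so that it becomes, normalised to length `B`,
the minimiser.

An evaluation of a derivative, or a factor of a hypergradient, lets the iterates reach at most one
more coordinate, so the output is supported on the first `M - 1` coordinates. The remaining part of
the minimiser is a shorter vector of the same kind, scaled by `r ^ (M - 1)`, so its norm is at least
a constant multiple of `r ^ M B`, and strong convexity turns this into the lower bound for the
optimality gap. As `-log r ≤ √s` and `s` is at most of order `μx μy² / (Ly Lgxy²)`, a small gap
needs many oracle calls. An algorithm that can exhaust the coordinates has `M > d / 2`, which is
large enough once `d` is large in terms of `ε`.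
-/

section QuadraticFunctions

variable {V : Type*} [NormedAddCommGroup V] [InnerProductSpace ℝ V] {T : V →L[ℝ] V} {μ : ℝ}

/-- The quadratic function `½⟪x, T x⟫ + ⟪w, x⟫ + c`. -/
noncomputable def quadFun (T : V →L[ℝ] V) (w : V) (c : ℝ) (x : V) : ℝ :=
  1 / 2 * inner ℝ x (T x) + inner ℝ w x + c

lemma norm_map_ge_of_coercive (h : ∀ x, μ * ‖x‖ ^ 2 ≤ inner ℝ x (T x)) (x : V) :
    μ * ‖x‖ ≤ ‖T x‖ := by
  rcases eq_or_ne x 0 with rfl | hx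
  · simp
  · refine le_of_mul_le_mul_left ?_ (norm_pos_iff.2 hx)
    linarith [(h x).trans (real_inner_le_norm x (T x))]

lemma strongConvexOn_quadFun (h : ∀ x, μ * ‖x‖ ^ 2 ≤ inner ℝ x (T x)) (w : V) (c : ℝ) :
    StrongConvexOn Set.univ μ (quadFun T w c) := by
  refine ⟨convex_univ, fun x _ y _ a b ha hb hab => ?_⟩
  obtain rfl : b = 1 - a := by linarith
  have hxy := mul_le_mul_of_nonneg_left (h (x - y)) (mul_nonneg ha hb)
  simp only [quadFun, map_add, map_sub, map_smul, inner_add_left, inner_add_right, inner_sub_left,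
    inner_sub_right, inner_smul_left, inner_smul_right, smul_eq_mul, RCLike.conj_to_real] at hxy ⊢
  linarith

variable [CompleteSpace V]

lemma isUnit_of_coercive (hμ : 0 < μ) (h : ∀ x, μ * ‖x‖ ^ 2 ≤ inner ℝ x (T x)) : IsUnit T := by
  refine T.isUnit_of_forall_le_norm_inner_map (c := ⟨μ, hμ.le⟩) hμ fun x => ?_
  rw [real_inner_comm, mul_comm]
  exact (h x).trans (le_abs_self _)

lemma quadFun_sub_quadFun (hT : IsSelfAdjoint T) {w x₀ : V} (h₀ : T x₀ + w = 0) (c : ℝ) (x : V) :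
    quadFun T w c x - quadFun T w c x₀ = 1 / 2 * inner ℝ (x - x₀) (T (x - x₀)) := by
  obtain rfl : w = -T x₀ := by rw [eq_neg_iff_add_eq_zero, add_comm, h₀]
  have hx : inner ℝ (T x₀) x = inner ℝ x₀ (T x) := hT.isSymmetric x₀ x
  simp only [quadFun, map_sub, inner_sub_left, inner_sub_right, inner_neg_left, ← hx,
    real_inner_comm x (T x₀), real_inner_comm x₀ (T x₀)]
  ring

lemma isMinOn_quadFun_iff (hT : IsSelfAdjoint T) (hμ : 0 < μ)
    (h : ∀ x, μ * ‖x‖ ^ 2 ≤ inner ℝ x (T x)) {w x₀ : V} (h₀ : T x₀ + w = 0) (c : ℝ) (x : V) :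
    IsMinOn (quadFun T w c) Set.univ x ↔ x = x₀ := by
  constructor
  · intro hx
    have hle : quadFun T w c x ≤ quadFun T w c x₀ := hx (Set.mem_univ x₀)
    have hsq : μ * ‖x - x₀‖ ^ 2 ≤ 0 := by
      linarith [h (x - x₀), quadFun_sub_quadFun hT h₀ c x]
    have hnorm : ‖x - x₀‖ ^ 2 ≤ 0 := nonpos_of_mul_nonpos_right hsq hμ
    exact sub_eq_zero.1 (norm_eq_zero.1 (pow_eq_zero_iff two_ne_zero |>.1
      (hnorm.antisymm (sq_nonneg _))))
  · rintro rfl y -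
    have hpos : 0 ≤ μ * ‖y - x‖ ^ 2 := by positivity
    change quadFun T w c x ≤ quadFun T w c y
    rw [← sub_nonneg, quadFun_sub_quadFun hT h₀]
    linarith [h (y - x)]

lemma gradient_quadFun (hT : IsSelfAdjoint T) (w : V) (c : ℝ) (x : V) :
    gradient (quadFun T w c) x = T x + w := by
  refine HasGradientAt.gradient ?_
  rw [hasGradientAt_iff_hasFDerivAt]
  have hquad : HasFDerivAt (fun x : V => inner ℝ x (T x)) _ x :=
    (hasFDerivAt_id x).inner ℝ T.hasFDerivAt
  have hlin : HasFDerivAt (fun x : V => inner ℝ w x) (innerSL ℝ w) x := (innerSL ℝ w).hasFDerivAt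
  refine (((hquad.const_mul (1 / 2)).add hlin).add_const c).congr_fderiv ?_
  ext z
  have hxz : inner ℝ (T x) z = inner ℝ x (T z) := hT.isSymmetric x z
  simp [fderivInnerCLM_apply, real_inner_comm (T x) z, ← hxz]
  ring

end QuadraticFunctions

section QuadraticBilevel

open ContinuousLinearMap

variable {X Y : Type*}
  [NormedAddCommGroup X] [InnerProductSpace ℝ X] [NormedAddCommGroup Y] [InnerProductSpace ℝ Y]
  {A : X →L[ℝ] X} {C J : Y →L[ℝ] X} {E H : Y →L[ℝ] Y} {u : X} {v b : Y}

/-- The quadratic upper-level objective `½⟪x, A x⟫ + ⟪x, C y⟫ + ½⟪y, E y⟫ + ⟪u, x⟫ + ⟪v, y⟫`. -/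
noncomputable def quadUpper (A : X →L[ℝ] X) (C : Y →L[ℝ] X) (E : Y →L[ℝ] Y) (u : X) (v : Y)
    (x : X) (y : Y) : ℝ :=
  1 / 2 * inner ℝ x (A x) + inner ℝ x (C y) + 1 / 2 * inner ℝ y (E y) + inner ℝ u x + inner ℝ v y

/-- The quadratic lower-level objective `½⟪y, H y⟫ + ⟪x, J y⟫ + ⟪b, y⟫`. -/
noncomputable def quadLower (H : Y →L[ℝ] Y) (J : Y →L[ℝ] X) (b : Y) (x : X) (y : Y) : ℝ :=
  1 / 2 * inner ℝ y (H y) + inner ℝ x (J y) + inner ℝ b y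

lemma contDiff_quadUpper {n : WithTop ℕ∞} :
    ContDiff ℝ n fun z : X × Y => quadUpper A C E u v z.1 z.2 := by
  have hx : ContDiff ℝ n (Prod.fst : X × Y → X) := contDiff_fst
  have hy : ContDiff ℝ n (Prod.snd : X × Y → Y) := contDiff_snd
  exact ((((contDiff_const.mul (hx.inner ℝ (A.contDiff.comp hx))).add
    (hx.inner ℝ (C.contDiff.comp hy))).add (contDiff_const.mul
    (hy.inner ℝ (E.contDiff.comp hy)))).add (contDiff_const.inner ℝ hx)).add
    (contDiff_const.inner ℝ hy)

lemma contDiff_quadLower {n : WithTop ℕ∞} :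
    ContDiff ℝ n fun z : X × Y => quadLower H J b z.1 z.2 := by
  have hx : ContDiff ℝ n (Prod.fst : X × Y → X) := contDiff_fst
  have hy : ContDiff ℝ n (Prod.snd : X × Y → Y) := contDiff_snd
  exact ((contDiff_const.mul (hy.inner ℝ (H.contDiff.comp hy))).add
    (hx.inner ℝ (J.contDiff.comp hy))).add (contDiff_const.inner ℝ hy)

lemma quadUpper_left (y : Y) : (fun x => quadUpper A C E u v x y) =
    quadFun A (C y + u) (1 / 2 * inner ℝ y (E y) + inner ℝ v y) := by
  ext x
  simp only [quadUpper, quadFun, inner_add_left, real_inner_comm x (C y)]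
  ring

lemma quadLower_left (y : Y) : (fun x => quadLower H J b x y) =
    quadFun 0 (J y) (1 / 2 * inner ℝ y (H y) + inner ℝ b y) := by
  ext x
  simp only [quadLower, quadFun, real_inner_comm x (J y), zero_apply, inner_zero_right]
  ring

variable [CompleteSpace X]

lemma gradX_quadUpper (hA : IsSelfAdjoint A) (x : X) (y : Y) :
    gradX (quadUpper A C E u v) x y = A x + (C y + u) := by
  rw [gradX, quadUpper_left, gradient_quadFun hA]

lemma gradX_quadLower (x : X) (y : Y) : gradX (quadLower H J b) x y = J y := by
  rw [gradX, quadLower_left, gradient_quadFun (.zero _), zero_apply, zero_add]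

lemma jacXY_quadLower (x : X) (y : Y) : jacXY (quadLower H J b) x y = J := by
  simp only [jacXY, gradX_quadLower]
  exact J.fderiv

variable [CompleteSpace Y]

lemma quadUpper_right (x : X) : quadUpper A C E u v x =
    quadFun E (C.adjoint x + v) (1 / 2 * inner ℝ x (A x) + inner ℝ u x) := by
  ext y
  simp only [quadUpper, quadFun, inner_add_left, adjoint_inner_left]
  ring

lemma quadLower_right (x : X) : quadLower H J b x = quadFun H (J.adjoint x + b) 0 := by
  ext y
  simp only [quadLower, quadFun, inner_add_left, adjoint_inner_left]
  ring

lemma gradY_quadUpper (hE : IsSelfAdjoint E) (x : X) (y : Y) :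
    gradY (quadUpper A C E u v) x y = E y + (C.adjoint x + v) := by
  rw [gradY, quadUpper_right, gradient_quadFun hE]

lemma gradY_quadLower (hH : IsSelfAdjoint H) (x : X) (y : Y) :
    gradY (quadLower H J b) x y = H y + (J.adjoint x + b) := by
  rw [gradY, quadLower_right, gradient_quadFun hH]

lemma hessY_quadLower (hH : IsSelfAdjoint H) (x : X) (y : Y) :
    hessY (quadLower H J b) x y = H := by
  simp only [hessY, gradY_quadLower hH, fderiv_add_const]
  exact H.fderiv

lemma innerArgmin_quadLower (hH : IsSelfAdjoint H) {μ : ℝ} (hμ : 0 < μ)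
    (h : ∀ y, μ * ‖y‖ ^ 2 ≤ inner ℝ y (H y)) (x : X) :
    innerArgmin (quadLower H J b) x = -Ring.inverse H (J.adjoint x + b) := by
  have hstat : H (-Ring.inverse H (J.adjoint x + b)) + (J.adjoint x + b) = 0 := by
    rw [map_neg, ← mul_apply_eq_comp, Ring.mul_inverse_cancel _ (isUnit_of_coercive hμ h),
      one_apply_eq_self, neg_add_cancel]
  have hiff := isMinOn_quadFun_iff hH hμ h hstat 0
  rw [innerArgmin, quadLower_right]
  exact (hiff _).1 (Classical.epsilon_spec ⟨_, (hiff _).2 rfl⟩)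

lemma totalObjective_quad (hE : IsSelfAdjoint E) (hH : IsSelfAdjoint H) {μ : ℝ} (hμ : 0 < μ)
    (h : ∀ y, μ * ‖y‖ ^ 2 ≤ inner ℝ y (H y)) {K : Y →L[ℝ] Y} (hK : Ring.inverse H = K) :
    totalObjective (quadUpper A C E u v) (quadLower H J b) =
      quadFun (A - C ∘L K ∘L J.adjoint - J ∘L K ∘L C.adjoint + J ∘L K ∘L E ∘L K ∘L J.adjoint)
        (u - C (K b) + J (K (E (K b))) - J (K v))
        (1 / 2 * inner ℝ (K b) (E (K b)) - inner ℝ v (K b)) := by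
  ext x
  have hKsymm : ∀ y z, inner ℝ (K y) z = inner ℝ y (K z) := (hK ▸ hH.ringInverse).isSymmetric
  have hEsymm : inner ℝ (K b) (E (K (J.adjoint x))) = inner ℝ (K (J.adjoint x)) (E (K b)) := by
    rw [real_inner_comm]
    exact hE.isSymmetric _ _
  have hJK : ∀ z, inner ℝ (J (K z)) x = inner ℝ z (K (J.adjoint x)) := fun z => by
    rw [← adjoint_inner_right, hKsymm]
  simp only [totalObjective, innerArgmin_quadLower hH hμ h, hK, quadUpper, quadFun, map_add,
    map_neg, inner_add_left, inner_add_right, inner_neg_left, inner_neg_right, add_apply, sub_apply,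
    comp_apply, inner_sub_left, inner_sub_right, real_inner_comm (J _) x, hJK, adjoint_inner_left,
    real_inner_comm x (C (K b)), hEsymm, real_inner_comm (K (J.adjoint x)) (E _)]
  ring

lemma scscClass_quad {T : X →L[ℝ] X} {w xs : X} {Lx Lxy Ly Lgxy Lgy ρxy ρyy μx μy c : ℝ}
    (hA : IsSelfAdjoint A) (hE : IsSelfAdjoint E) (hH : IsSelfAdjoint H)
    (nA : ‖A‖ ≤ Lx) (nC : ‖C‖ ≤ Lxy) (nE : ‖E‖ ≤ Ly) (nJ : ‖J‖ ≤ Lgxy) (nH : ‖H‖ ≤ Lgy)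
    (hρxy : 0 ≤ ρxy) (hρyy : 0 ≤ ρyy) (cH : ∀ y, μy * ‖y‖ ^ 2 ≤ inner ℝ y (H y))
    (hΦ : totalObjective (quadUpper A C E u v) (quadLower H J b) = quadFun T w c)
    (cT : ∀ x, μx * ‖x‖ ^ 2 ≤ inner ℝ x (T x))
    (hxs : IsMinOn (totalObjective (quadUpper A C E u v) (quadLower H J b)) Set.univ xs) :
    SCSCClass Lx Lxy Ly Lgxy Lgy ρxy ρyy μx μy ‖xs‖ (quadUpper A C E u v) (quadLower H J b) where
  contDiff_f := contDiff_quadUpper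
  contDiff_g := contDiff_quadLower
  gradX_f_x x₁ x₂ y := by
    simpa only [gradX_quadUpper hA, add_sub_add_right_eq_sub, ← map_sub]
      using A.le_of_opNorm_le nA _
  gradX_f_y x y₁ y₂ := by
    simpa only [gradX_quadUpper hA, add_sub_add_left_eq_sub, add_sub_add_right_eq_sub, ← map_sub]
      using C.le_of_opNorm_le nC _
  gradY_f_x x₁ x₂ y := by
    simpa only [gradY_quadUpper hE, add_sub_add_left_eq_sub, add_sub_add_right_eq_sub, ← map_sub]
      using C.adjoint.le_of_opNorm_le ((LinearIsometryEquiv.norm_map _ C).trans_le nC) _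
  gradY_f_y x y₁ y₂ := by
    simpa only [gradY_quadUpper hE, add_sub_add_right_eq_sub, ← map_sub]
      using E.le_of_opNorm_le nE _
  gradY_g_x x₁ x₂ y := by
    simpa only [gradY_quadLower hH, add_sub_add_left_eq_sub, add_sub_add_right_eq_sub, ← map_sub]
      using J.adjoint.le_of_opNorm_le ((LinearIsometryEquiv.norm_map _ J).trans_le nJ) _
  gradY_g_y x y₁ y₂ := by
    simpa only [gradY_quadLower hH, add_sub_add_right_eq_sub, ← map_sub]
      using H.le_of_opNorm_le nH _
  jacXY_g x₁ x₂ y₁ y₂ := by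
    rw [jacXY_quadLower, jacXY_quadLower, sub_self, norm_zero]
    positivity
  hessY_g x₁ x₂ y₁ y₂ := by
    rw [hessY_quadLower hH, hessY_quadLower hH, sub_self, norm_zero]
    positivity
  strongConvex_g x := quadLower_right (H := H) (J := J) x ▸ strongConvexOn_quadFun cH _ _
  strongConvex_total := hΦ ▸ strongConvexOn_quadFun cT _ _
  exists_minimiser := ⟨xs, hxs, rfl⟩

end QuadraticBilevel

section SearchSpaces

variable {X Y : Type*}
  [NormedAddCommGroup X] [InnerProductSpace ℝ X] [CompleteSpace X]
  [NormedAddCommGroup Y] [InnerProductSpace ℝ Y] [CompleteSpace Y]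
  {f g : X → Y → ℝ} {T : ℕ} {PX : ℕ → Submodule ℝ X} {PY : ℕ → Submodule ℝ Y}

lemma xGenerators_mono {Hx Hx' : Submodule ℝ X} {Hy Hy' : Submodule ℝ Y} (hx : Hx ≤ Hx')
    (hy : Hy ≤ Hy') : xGenerators f g T Hx Hy ⊆ xGenerators f g T Hx' Hy' := by
  rintro w (hw | ⟨x, hxm, y, hym, rfl⟩ | ⟨t, α, a, c, z, ht, ha, hc, hz, rfl⟩)
  · exact .inl (hx hw)
  · exact .inr (.inl ⟨x, hx hxm, y, hy hym, rfl⟩)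
  · exact .inr (.inr ⟨t, α, a, c, z, ht, ⟨hx ha.1, hy ha.2⟩, ⟨hx hc.1, hy hc.2⟩,
      fun j => ⟨hx (hz j).1, hy (hz j).2⟩, rfl⟩)

omit [CompleteSpace X] in
lemma yGenerators_mono {Hx Hx' : Submodule ℝ X} {Hy Hy' : Submodule ℝ Y} (hx : Hx ≤ Hx')
    (hy : Hy ≤ Hy') : yGenerators g Hx Hy ⊆ yGenerators g Hx' Hy' := by
  rintro w (hw | ⟨x, hxm, y, hym, rfl⟩)
  · exact .inl (hy hw)
  · exact .inr ⟨x, hx hxm, y, hy hym, rfl⟩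

lemma searchSpaces_le (hPX : Monotone PX) (hPY : Monotone PY)
    (hx : ∀ m, xGenerators f g T (PX m) (PY m) ⊆ PX (m + T + 2))
    (hy : ∀ m, yGenerators g (PX m) (PY m) ⊆ PY (m + 1)) {upd : Set ℕ} {N : ℕ → ℕ}
    (hN : ∀ k, N k + 1 ≤ N (k + 1)) (hNupd : ∀ k, k + 1 ∈ upd → N k + T + 2 ≤ N (k + 1)) (k : ℕ) :
    searchSpaces f g T upd k ≤ (PX (N k), PY (N k)) := by
  have hNmono : Monotone N := monotone_nat_of_le_succ fun k => (Nat.le_succ _).trans (hN k)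
  induction k using Nat.strong_induction_on with
  | _ k ih =>
  rcases k with _ | k
  · rw [searchSpaces]
    exact ⟨bot_le, bot_le⟩
  have hle : ∀ i : Fin (k + 1), searchSpaces f g T upd i ≤ (PX (N k), PY (N k)) := fun i =>
    (ih i i.2).trans ⟨hPX (hNmono i.is_le), hPY (hNmono i.is_le)⟩
  rw [searchSpaces]
  refine ⟨?_, Submodule.span_le.2 (Set.iUnion_subset fun i => ?_)⟩
  · dsimp only
    split_ifs with hk
    · exact Submodule.span_le.2 (Set.iUnion_subset fun i =>
        (xGenerators_mono (hle i).1 (hle i).2).trans ((hx _).trans (hPX (hNupd k hk))))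
    · exact (hle (Fin.last k)).1.trans (hPX (hNmono k.le_succ))
  · exact (yGenerators_mono (hle i).1 (hle i).2).trans ((hy _).trans (hPY (hN k)))

lemma AlgorithmSchedule.outputSpace_le (S : AlgorithmSchedule) (hPX : Monotone PX)
    (hPY : Monotone PY) (hx : ∀ m, xGenerators f g S.T (PX m) (PY m) ⊆ PX (m + S.T + 2))
    (hy : ∀ m, yGenerators g (PX m) (PY m) ⊆ PY (m + 1)) :
    S.outputSpace f g ≤ PX (S.M - 2) := by
  let updates (k : ℕ) : Finset (Fin S.Q) := {j | S.s j ≤ k}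
  have hmono : ∀ k, updates k ⊆ updates (k + 1) := fun k =>
    Finset.monotone_filter_right _ fun _ _ h => h.trans k.le_succ
  have hupd : ∀ k, k + 1 ∈ Set.range S.s → (updates k).card + 1 ≤ (updates (k + 1)).card := by
    rintro k ⟨j, hj⟩
    refine Finset.card_lt_card ((hmono k).ssubset_of_mem_notMem (a := j) ?_ ?_) <;>
      simp [updates, hj]
  refine (searchSpaces_le hPX hPY hx hy (N := fun k => k + (S.T + 1) * (updates k).card)
    (fun k => ?_) (fun k hk => ?_) S.K).1.trans (hPX ?_)
  · have := Nat.mul_le_mul_left (S.T + 1) (Finset.card_le_card (hmono k))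
    lia
  · have := Nat.mul_le_mul_left (S.T + 1) (hupd k hk)
    lia
  · have hQ : (updates S.K).card ≤ S.Q := (Finset.card_le_univ _).trans_eq (Fintype.card_fin _)
    have := Nat.mul_le_mul_left (S.T + 1) hQ
    have : (S.T + 1) * S.Q = S.Q * S.T + S.Q := by ring
    rw [M]
    lia

variable {A : X →L[ℝ] X} {C J : Y →L[ℝ] X} {E H : Y →L[ℝ] Y} {u : X} {v b : Y}

omit [CompleteSpace Y] in
lemma pow_one_sub_smul_mem (hPY : Monotone PY) (hH : ∀ m, Set.MapsTo H (PY m) (PY (m + 1)))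
    (θ : ℝ) (t : ℕ) {m : ℕ} {y : Y} (hy : y ∈ PY m) : ((1 - θ • H) ^ t) y ∈ PY (m + t) := by
  induction t with
  | zero => simpa using hy
  | succ t ih =>
    rw [pow_succ', mul_apply_eq_comp, sub_apply, one_apply_eq_self, smul_apply]
    exact sub_mem (hPY (Nat.le_succ _) ih) (Submodule.smul_mem _ _ (hH _ ih))

lemma outputSpace_quad_le (hPX : Monotone PX) (hPY : Monotone PY) (sA : IsSelfAdjoint A)
    (sE : IsSelfAdjoint E) (sH : IsSelfAdjoint H) (hA : ∀ m, Set.MapsTo A (PX m) (PX (m + 1)))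
    (hC : ∀ m, Set.MapsTo C (PY m) (PX (m + 1)))
    (hC' : ∀ m, Set.MapsTo C.adjoint (PX m) (PY (m + 2)))
    (hE : ∀ m, Set.MapsTo E (PY m) (PY (m + 2))) (hH : ∀ m, Set.MapsTo H (PY m) (PY (m + 1)))
    (hJ : ∀ m, Set.MapsTo J (PY m) (PX m)) (hJ' : ∀ m, Set.MapsTo J.adjoint (PX m) (PY (m + 1)))
    (hu : u ∈ PX 1) (hv : v ∈ PY 2) (hb : b ∈ PY 1) (S : AlgorithmSchedule) :
    S.outputSpace (quadUpper A C E u v) (quadLower H J b) ≤ PX (S.M - 2) := by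
  refine S.outputSpace_le hPX hPY (fun m => ?_) (fun m => ?_)
  · rintro w (hw | ⟨x, hx, y, hy, rfl⟩ | ⟨t, θ, p, c, z, ht, -, hc, -, rfl⟩)
    · exact hPX (by lia) hw
    · rw [gradX_quadUpper sA]
      exact hPX (show m + 1 ≤ m + S.T + 2 by lia)
        (add_mem (hA m hx) (add_mem (hC m hy) (hPX (by lia) hu)))
    · have hgrad : E c.2 + (C.adjoint c.1 + v) ∈ PY (m + 2) :=
        add_mem (hE m hc.2) (add_mem (hC' m hc.1) (hPY (by lia) hv))
      simp only [gradY_quadUpper sE, jacXY_quadLower, hessY_quadLower sH, List.ofFn_const,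
        List.prod_replicate]
      exact hPX (show m + 2 + t ≤ m + S.T + 2 by lia)
        (hJ _ (pow_one_sub_smul_mem hPY hH θ t hgrad))
  · rintro w (hw | ⟨x, hx, y, hy, rfl⟩)
    · exact hPY m.le_succ hw
    · rw [gradY_quadLower sH]
      exact add_mem (hH m hy) (add_mem (hJ' m hx) (hPY (by lia) hb))

end SearchSpaces

section SquareOperators

variable {V : Type*} [NormedAddCommGroup V] [InnerProductSpace ℝ V] {Z : V →L[ℝ] V}

/-- The operator `a Z² + c`. -/
noncomputable def sqOp (Z : V →L[ℝ] V) (a c : ℝ) : V →L[ℝ] V := a • Z ^ 2 + c • 1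

lemma sqOp_apply (a c : ℝ) (x : V) : sqOp Z a c x = a • Z (Z x) + c • x := by
  simp [sqOp, pow_two]

lemma norm_sqOp_le {m a c : ℝ} (hZ : ‖Z‖ ≤ m) (ha : 0 ≤ a) (hc : 0 ≤ c) :
    ‖sqOp Z a c‖ ≤ a * m ^ 2 + c := by
  have hsq : ‖Z ^ 2‖ ≤ m ^ 2 := (norm_pow_le' Z two_pos).trans (by gcongr)
  have hone : ‖(1 : V →L[ℝ] V)‖ ≤ 1 := ContinuousLinearMap.norm_id_le
  calc ‖sqOp Z a c‖ ≤ ‖a • Z ^ 2‖ + ‖c • (1 : V →L[ℝ] V)‖ := norm_add_le _ _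
    _ ≤ a * m ^ 2 + c * 1 := by
      rw [norm_smul, norm_smul, Real.norm_of_nonneg ha, Real.norm_of_nonneg hc]
      gcongr
    _ = a * m ^ 2 + c := by ring

variable [CompleteSpace V]

lemma isSelfAdjoint_sqOp (hZ : IsSelfAdjoint Z) (a c : ℝ) : IsSelfAdjoint (sqOp Z a c) :=
  ((IsSelfAdjoint.all a).smul (hZ.pow 2)).add ((IsSelfAdjoint.all c).smul (.one _))

lemma coercive_sqOp (hZ : IsSelfAdjoint Z) {a : ℝ} (ha : 0 ≤ a) (c : ℝ) (x : V) :
    c * ‖x‖ ^ 2 ≤ inner ℝ x (sqOp Z a c x) := by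
  have hZx : inner ℝ x (Z (Z x)) = ‖Z x‖ ^ 2 := by
    rw [← real_inner_self_eq_norm_sq]
    exact (hZ.isSymmetric x (Z x)).symm
  rw [sqOp_apply, inner_add_right, inner_smul_right, inner_smul_right, hZx,
    real_inner_self_eq_norm_sq]
  exact le_add_of_nonneg_left (by positivity)

end SquareOperators

/-- The constants of the class of bilevel problems that determine the hard instance. -/
structure BilevelConstants where
  Lx : ℝ
  Ly : ℝ
  Lgxy : ℝ
  Lgy : ℝ
  μx : ℝ
  μy : ℝ
  Ly_pos : 0 < Ly
  Lgxy_pos : 0 < Lgxy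
  μx_pos : 0 < μx
  μx_le : μx ≤ Lx
  μy_pos : 0 < μy
  μy_le : μy ≤ Lgy

namespace BilevelConstants

variable (P : BilevelConstants)

/-- The coefficient of `Z²` in the Hessian of the upper objective of the hard instance. With
`‖Z‖ ≤ 2` it makes `Lx` the norm bound of `α Z² + μx`. -/
noncomputable def α : ℝ := (P.Lx - P.μx) / 4

/-- The coefficient of `Z²` in the Hessian of the lower objective of the hard instance. With
`‖Z‖ ≤ 2` it makes `Lgy` the norm bound of `β Z² + μy`. -/
noncomputable def β : ℝ := (P.Lgy - P.μy) / 4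

/-- The leading coefficient of the polynomial `q Z⁴ + l Z² + c` of the normal equation. -/
noncomputable def q : ℝ := P.α * P.β * P.μy + P.β ^ 2 * P.μx

/-- The middle coefficient of the polynomial `q Z⁴ + l Z² + c` of the normal equation. -/
noncomputable def l : ℝ :=
  P.α * P.μy ^ 2 + 2 * P.β * P.μx * P.μy + P.Ly * P.Lgxy ^ 2 / 4

/-- The constant coefficient of the polynomial `q Z⁴ + l Z² + c` of the normal equation. -/
noncomputable def c : ℝ := P.μx * P.μy ^ 2

/-- The constant term of the first factor in `q Z⁴ + l Z² + c = (q Z² + k) (Z² + s)`. -/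
noncomputable def k : ℝ := (P.l + √(P.l ^ 2 - 4 * P.q * P.c)) / 2

/-- The constant term of the second factor in `q Z⁴ + l Z² + c = (q Z² + k) (Z² + s)`, written
as `c / k` so that the degenerate case `q = 0` is included. -/
noncomputable def s : ℝ := P.c / P.k

lemma α_nonneg : 0 ≤ P.α := div_nonneg (sub_nonneg.2 P.μx_le) zero_le_four

lemma β_nonneg : 0 ≤ P.β := div_nonneg (sub_nonneg.2 P.μy_le) zero_le_four

lemma c_pos : 0 < P.c := mul_pos P.μx_pos (pow_pos P.μy_pos 2)

lemma l_pos : 0 < P.l := by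
  have := P.α_nonneg
  have := P.β_nonneg
  have := P.μx_pos
  have := P.μy_pos
  have := P.Ly_pos
  have := P.Lgxy_pos
  unfold l
  positivity

lemma four_mul_q_mul_c_lt : 4 * P.q * P.c < P.l ^ 2 := by
  have := P.α_nonneg
  have := P.β_nonneg
  have := P.μx_pos
  have := P.μy_pos
  have he : 0 < P.Ly * P.Lgxy ^ 2 / 4 :=
    div_pos (mul_pos P.Ly_pos (pow_pos P.Lgxy_pos 2)) four_pos
  have hdiff : P.l ^ 2 - 4 * P.q * P.c = (P.α * P.μy ^ 2) ^ 2 + (P.Ly * P.Lgxy ^ 2 / 4) *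
      (2 * (P.α * P.μy ^ 2 + 2 * P.β * P.μx * P.μy) + P.Ly * P.Lgxy ^ 2 / 4) := by
    simp only [l, q, c]
    ring
  rw [← sub_pos, hdiff]
  positivity

lemma k_pos : 0 < P.k := half_pos (add_pos_of_pos_of_nonneg P.l_pos (Real.sqrt_nonneg _))

lemma s_pos : 0 < P.s := div_pos P.c_pos P.k_pos

lemma k_mul_s : P.k * P.s = P.c := mul_div_cancel₀ P.c P.k_pos.ne'

lemma q_mul_s_add_k : P.q * P.s + P.k = P.l := by
  have hroot : P.k ^ 2 + P.q * P.c = P.l * P.k := by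
    have hsq := Real.sq_sqrt (sub_nonneg.2 P.four_mul_q_mul_c_lt.le)
    unfold k
    linear_combination hsq / 4
  have hk := P.k_pos.ne'
  rw [s]
  field_simp
  linarith

lemma s_mul_l_lt : P.s * (P.l / (2 * P.c)) < 1 := by
  have hk : P.l < 2 * P.k := by
    have := Real.sqrt_pos.2 (sub_pos.2 P.four_mul_q_mul_c_lt)
    unfold k
    linarith
  have := P.c_pos
  have := P.k_pos
  rw [s, div_mul_div_comm, div_lt_one (by positivity)]
  linarith [mul_lt_mul_of_pos_left hk P.c_pos]

variable {V : Type*} [NormedAddCommGroup V] [InnerProductSpace ℝ V] (Z : V →L[ℝ] V) (b : V)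

/-- The upper objective of the hard instance. Its linear term cancels, in the gradient of the total
objective, the contribution of the coupling `x, y ↦ ⟪x, Z³ y⟫` to the linear part. -/
noncomputable def upper : V → V → ℝ :=
  quadUpper (sqOp Z P.α P.μx) ((P.α * P.β / P.Lgxy) • Z ^ 3) (P.Ly • 1) 0
    (-(2 * P.α * P.β / P.Lgxy ^ 2) • Z (Z b))

/-- The lower objective of the hard instance. -/
noncomputable def lower : V → V → ℝ :=
  quadLower (sqOp Z P.β P.μy) ((P.Lgxy / 2) • Z) b

/-- The inverse of the Hessian `β Z² + μy` of the lower objective. -/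
noncomputable def invHess : V →L[ℝ] V := Ring.inverse (sqOp Z P.β P.μy)

/-- The Hessian of the total objective of the hard instance. -/
noncomputable def totalHess : V →L[ℝ] V :=
  P.μx • 1 + (P.α * P.μy) • (Z * P.invHess Z * Z) +
    (P.Ly * P.Lgxy ^ 2 / 4) • (Z * P.invHess Z ^ 2 * Z)

variable {P Z b} [CompleteSpace V] (hZ : IsSelfAdjoint Z)
include hZ

lemma isUnit_lowerHess : IsUnit (sqOp Z P.β P.μy) :=
  isUnit_of_coercive P.μy_pos (coercive_sqOp hZ P.β_nonneg _)

lemma sqOp_invHess (x : V) : sqOp Z P.β P.μy (P.invHess Z x) = x := by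
  rw [invHess, ← mul_apply_eq_comp, Ring.mul_inverse_cancel _ (isUnit_lowerHess hZ),
    one_apply_eq_self]

lemma isSelfAdjoint_invHess : IsSelfAdjoint (P.invHess Z) := (isSelfAdjoint_sqOp hZ _ _).ringInverse

lemma invHess_map (x : V) : P.invHess Z (Z x) = Z (P.invHess Z x) := by
  have hcomm : Commute (sqOp Z P.β P.μy) Z :=
    (((Commute.refl Z).pow_left 2).smul_left _).add_left ((Commute.one_left Z).smul_left _)
  obtain ⟨H, hH⟩ := isUnit_lowerHess (P := P) hZ
  rw [← hH] at hcomm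
  rw [invHess, ← hH, Ring.inverse_unit]
  exact congr($(hcomm.units_inv_left) x)

lemma norm_invHess_le (x : V) : ‖P.invHess Z x‖ ≤ ‖x‖ / P.μy := by
  rw [le_div_iff₀' P.μy_pos]
  simpa only [sqOp_invHess hZ] using
    norm_map_ge_of_coercive (coercive_sqOp hZ P.β_nonneg P.μy) (P.invHess Z x)

lemma inner_invHess_nonneg (x : V) : 0 ≤ inner ℝ x (P.invHess Z x) := by
  have hpos : 0 ≤ P.μy * ‖P.invHess Z x‖ ^ 2 := mul_nonneg P.μy_pos.le (sq_nonneg _)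
  have := hpos.trans (coercive_sqOp hZ P.β_nonneg P.μy (P.invHess Z x))
  rwa [sqOp_invHess hZ, real_inner_comm] at this

lemma smul_map_map_invHess (x : V) :
    P.β • Z (Z (P.invHess Z x)) = x - P.μy • P.invHess Z x := by
  rw [eq_sub_iff_add_eq, ← sqOp_apply, sqOp_invHess hZ]

lemma totalObjective_eq : totalObjective (P.upper Z b) (P.lower Z b) =
    quadFun (P.totalHess Z) ((P.Ly * P.Lgxy / 2) • Z (P.invHess Z (P.invHess Z b)))
      (P.Ly / 2 * ‖P.invHess Z b‖ ^ 2 +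
        2 * P.α * P.β / P.Lgxy ^ 2 * inner ℝ (Z (Z b)) (P.invHess Z b)) := by
  have hL := P.Lgxy_pos.ne'
  have hsmul : ∀ (a : ℝ) {S : V →L[ℝ] V}, IsSelfAdjoint S → (a • S).adjoint = a • S :=
    fun a S hS => ((IsSelfAdjoint.all a).smul hS).adjoint_eq
  have hE : IsSelfAdjoint (P.Ly • (1 : V →L[ℝ] V)) := (IsSelfAdjoint.all _).smul (.one _)
  have hγ : P.α * P.β / P.Lgxy * P.Lgxy = P.α * P.β := by field_simp
  have hγ' : 2 * P.α * P.β / P.Lgxy ^ 2 * P.Lgxy = 2 * (P.α * P.β / P.Lgxy) := by field_simp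
  rw [upper, lower, totalObjective_quad hE (isSelfAdjoint_sqOp hZ _ _) P.μy_pos
    (coercive_sqOp hZ P.β_nonneg _) rfl, hsmul _ hZ, hsmul _ (hZ.pow 3), ← invHess]
  congr 1
  · ext x
    -- With `K = (β Z² + μy)⁻¹`, the cubic coupling contributes `-αβ Z⁴ K = -α Z² + α μy Z² K`.
    have hK := congr(Z (Z $(smul_map_map_invHess (P := P) hZ x)))
    simp only [totalHess, add_apply, sub_apply, smul_apply, one_apply_eq_self, mul_apply_eq_comp,
      ContinuousLinearMap.comp_apply, pow_succ, pow_zero, one_mul, sqOp_apply, map_smul,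
      map_sub, invHess_map hZ] at hK ⊢
    linear_combination (norm := module) (-P.α) • hK - hγ • Z (Z (Z (Z (P.invHess Z x))))
  · simp only [smul_apply, one_apply_eq_self, mul_apply_eq_comp, pow_succ, pow_zero, one_mul,
      map_smul, map_neg, neg_smul, invHess_map hZ]
    linear_combination (norm := module) (1 / 2 : ℝ) • hγ' • Z (Z (Z (P.invHess Z b)))
  · simp only [smul_apply, one_apply_eq_self, inner_smul_right, inner_neg_left, neg_smul,
      inner_smul_left, real_inner_self_eq_norm_sq, RCLike.conj_to_real]
    ring

lemma inner_totalHess (x : V) : inner ℝ x (P.totalHess Z x) = P.μx * ‖x‖ ^ 2 +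
    P.α * P.μy * inner ℝ (Z x) (P.invHess Z (Z x)) +
    P.Ly * P.Lgxy ^ 2 / 4 * ‖P.invHess Z (Z x)‖ ^ 2 := by
  have hZsymm : ∀ y, inner ℝ x (Z y) = inner ℝ (Z x) y := fun y => (hZ.isSymmetric x y).symm
  have hKsymm : inner ℝ (Z x) (P.invHess Z (P.invHess Z (Z x))) = ‖P.invHess Z (Z x)‖ ^ 2 := by
    rw [← real_inner_self_eq_norm_sq]
    exact ((isSelfAdjoint_invHess hZ).isSymmetric _ _).symm
  simp only [totalHess, add_apply, smul_apply, one_apply_eq_self, mul_apply_eq_comp, pow_two,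
    inner_add_right, inner_smul_right, hZsymm, hKsymm, real_inner_self_eq_norm_sq]

lemma isSelfAdjoint_totalHess : IsSelfAdjoint (P.totalHess Z) := by
  have hK := isSelfAdjoint_invHess (P := P) hZ
  exact (((IsSelfAdjoint.all _).smul (.one _)).add
    ((IsSelfAdjoint.all _).smul (hK.conjugate_self hZ))).add
    ((IsSelfAdjoint.all _).smul ((hK.pow 2).conjugate_self hZ))

lemma coercive_totalHess (x : V) : P.μx * ‖x‖ ^ 2 ≤ inner ℝ x (P.totalHess Z x) := by
  have h₁ := mul_nonneg (mul_nonneg P.α_nonneg P.μy_pos.le) (inner_invHess_nonneg (P := P) hZ (Z x))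
  have h₂ : 0 ≤ P.Ly * P.Lgxy ^ 2 / 4 * ‖P.invHess Z (Z x)‖ ^ 2 := by
    have := P.Ly_pos
    positivity
  rw [inner_totalHess hZ]
  linarith

lemma inner_totalHess_le (nZ : ‖Z‖ ≤ 2) (x : V) :
    inner ℝ x (P.totalHess Z x) ≤ (P.Lx + P.Ly * P.Lgxy ^ 2 / P.μy ^ 2) * ‖x‖ ^ 2 := by
  have hα := P.α_nonneg
  have hLy := P.Ly_pos
  have hμy := P.μy_pos
  have hZx : ‖Z x‖ ^ 2 ≤ 4 * ‖x‖ ^ 2 := by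
    calc ‖Z x‖ ^ 2 ≤ (2 * ‖x‖) ^ 2 := by gcongr; exact Z.le_of_opNorm_le nZ x
      _ = 4 * ‖x‖ ^ 2 := by ring
  have hK := norm_invHess_le (P := P) hZ (Z x)
  have hfirst : inner ℝ (Z x) (P.invHess Z (Z x)) ≤ 4 * ‖x‖ ^ 2 / P.μy := by
    calc inner ℝ (Z x) (P.invHess Z (Z x)) ≤ ‖Z x‖ * ‖P.invHess Z (Z x)‖ := real_inner_le_norm _ _
      _ ≤ ‖Z x‖ * (‖Z x‖ / P.μy) := by gcongr
      _ = ‖Z x‖ ^ 2 / P.μy := by ring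
      _ ≤ 4 * ‖x‖ ^ 2 / P.μy := by gcongr
  have hsecond : ‖P.invHess Z (Z x)‖ ^ 2 ≤ 4 * ‖x‖ ^ 2 / P.μy ^ 2 := by
    calc ‖P.invHess Z (Z x)‖ ^ 2 ≤ (‖Z x‖ / P.μy) ^ 2 := by gcongr
      _ = ‖Z x‖ ^ 2 / P.μy ^ 2 := div_pow _ _ _
      _ ≤ 4 * ‖x‖ ^ 2 / P.μy ^ 2 := by gcongr
  calc inner ℝ x (P.totalHess Z x)
      ≤ P.μx * ‖x‖ ^ 2 + P.α * P.μy * (4 * ‖x‖ ^ 2 / P.μy) +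
        P.Ly * P.Lgxy ^ 2 / 4 * (4 * ‖x‖ ^ 2 / P.μy ^ 2) := by rw [inner_totalHess hZ]; gcongr
    _ = (P.Lx + P.Ly * P.Lgxy ^ 2 / P.μy ^ 2) * ‖x‖ ^ 2 := by
      unfold α
      field_simp
      ring

lemma totalHess_eq_invHess (x : V) : P.totalHess Z x =
    P.invHess Z (P.invHess Z (sqOp Z P.q P.k (sqOp Z 1 P.s x))) := by
  obtain ⟨y, hy⟩ : ∃ y, P.invHess Z (P.invHess Z x) = y := ⟨_, rfl⟩
  have hKx : P.invHess Z x = sqOp Z P.β P.μy y := by rw [← hy, sqOp_invHess hZ]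
  have hx : x = sqOp Z P.β P.μy (sqOp Z P.β P.μy y) := by rw [← hKx, sqOp_invHess hZ]
  have hl := P.q_mul_s_add_k
  have hc := P.k_mul_s
  have hlhs : P.totalHess Z x = P.μx • x + (P.α * P.μy) • Z (Z (P.invHess Z x)) +
      (P.Ly * P.Lgxy ^ 2 / 4) • Z (Z (P.invHess Z (P.invHess Z x))) := by
    simp only [totalHess, add_apply, smul_apply, one_apply_eq_self, mul_apply_eq_comp, pow_two,
      invHess_map hZ]
  have hrhs : P.invHess Z (P.invHess Z (sqOp Z P.q P.k (sqOp Z 1 P.s x))) =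
      P.q • Z (Z (Z (Z y))) + P.l • Z (Z y) + P.c • y := by
    simp only [sqOp_apply, map_add, map_smul, invHess_map hZ, hy, ← hl, ← hc]
    module
  rw [hlhs, hrhs, hy, hKx]
  conv_lhs => rw [hx]
  simp only [sqOp_apply, map_add, map_smul, q, l, c]
  module

lemma totalHess_add_eq_zero {x : V}
    (h : sqOp Z P.q P.k (sqOp Z 1 P.s x) + (P.Ly * P.Lgxy / 2) • Z b = 0) :
    P.totalHess Z x + (P.Ly * P.Lgxy / 2) • Z (P.invHess Z (P.invHess Z b)) = 0 := by
  rw [totalHess_eq_invHess hZ, eq_neg_of_add_eq_zero_left h]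
  simp only [map_neg, map_smul, invHess_map hZ, neg_add_cancel]

variable {x xs : V} (hxs : sqOp Z P.q P.k (sqOp Z 1 P.s xs) + (P.Ly * P.Lgxy / 2) • Z b = 0)
include hxs

lemma isMinOn_totalObjective :
    IsMinOn (totalObjective (P.upper Z b) (P.lower Z b)) Set.univ xs := by
  rw [totalObjective_eq hZ]
  exact (isMinOn_quadFun_iff (isSelfAdjoint_totalHess hZ) P.μx_pos (coercive_totalHess hZ)
    (totalHess_add_eq_zero hZ hxs) _ _).2 rfl

lemma totalObjective_sub (x : V) :
    totalObjective (P.upper Z b) (P.lower Z b) x - totalObjective (P.upper Z b) (P.lower Z b) xs =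
      1 / 2 * inner ℝ (x - xs) (P.totalHess Z (x - xs)) := by
  rw [totalObjective_eq hZ]
  exact quadFun_sub_quadFun (isSelfAdjoint_totalHess hZ) (totalHess_add_eq_zero hZ hxs) _ x

lemma le_totalObjective_sub (x : V) : P.μx / 2 * ‖x - xs‖ ^ 2 ≤
    totalObjective (P.upper Z b) (P.lower Z b) x -
      totalObjective (P.upper Z b) (P.lower Z b) xs := by
  rw [totalObjective_sub hZ hxs]
  linarith [coercive_totalHess (P := P) hZ (x - xs)]

variable (nZ : ‖Z‖ ≤ 2)
include nZ

lemma totalObjective_sub_le (x : V) :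
    totalObjective (P.upper Z b) (P.lower Z b) x - totalObjective (P.upper Z b) (P.lower Z b) xs ≤
      (P.Lx + P.Ly * P.Lgxy ^ 2 / P.μy ^ 2) / 2 * ‖x - xs‖ ^ 2 := by
  rw [totalObjective_sub hZ hxs]
  linarith [inner_totalHess_le (P := P) hZ nZ (x - xs)]

lemma scscClass {Lxy ρxy ρyy : ℝ} (hLxy : (P.Lx - P.μx) * (P.Lgy - P.μy) / (2 * P.Lgxy) ≤ Lxy)
    (hρxy : 0 ≤ ρxy) (hρyy : 0 ≤ ρyy) :
    SCSCClass P.Lx Lxy P.Ly P.Lgxy P.Lgy ρxy ρyy P.μx P.μy ‖xs‖ (P.upper Z b) (P.lower Z b) := by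
  have hα := P.α_nonneg
  have hβ := P.β_nonneg
  have hL := P.Lgxy_pos
  refine scscClass_quad (isSelfAdjoint_sqOp hZ _ _) ((IsSelfAdjoint.all _).smul (.one _))
    (isSelfAdjoint_sqOp hZ _ _) ?_ ?_ ?_ ?_ ?_ hρxy hρyy (coercive_sqOp hZ hβ _)
    (totalObjective_eq hZ) (coercive_totalHess hZ) (isMinOn_totalObjective hZ hxs)
  · exact (norm_sqOp_le nZ hα P.μx_pos.le).trans_eq (by rw [α]; ring)
  · calc ‖(P.α * P.β / P.Lgxy) • Z ^ 3‖ ≤ P.α * P.β / P.Lgxy * 2 ^ 3 := by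
          rw [norm_smul, Real.norm_of_nonneg (by positivity)]
          gcongr
          exact (norm_pow_le' Z three_pos).trans (by gcongr)
      _ = (P.Lx - P.μx) * (P.Lgy - P.μy) / (2 * P.Lgxy) := by
          unfold α β
          field_simp
          ring
      _ ≤ Lxy := hLxy
  · rw [norm_smul, Real.norm_of_nonneg P.Ly_pos.le]
    exact mul_le_of_le_one_right P.Ly_pos.le ContinuousLinearMap.norm_id_le
  · rw [norm_smul, Real.norm_of_nonneg (by positivity)]
    linarith [mul_le_mul_of_nonneg_left nZ hL.le]
  · exact (norm_sqOp_le nZ hβ P.μy_pos.le).trans_eq (by rw [β]; ring)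

end BilevelConstants

section CouplingMatrix

variable {d : ℕ}

/-- The `n`-th coordinate of a vector, with `n` a natural number: it is `0` for `n ≥ d`, which
removes the boundary cases from the action of the coupling matrix. -/
noncomputable def coord (x : EuclideanSpace ℝ (Fin d)) (n : ℕ) : ℝ :=
  if h : n < d then x ⟨n, h⟩ else 0

lemma coord_of_le (x : EuclideanSpace ℝ (Fin d)) {n : ℕ} (h : d ≤ n) : coord x n = 0 :=
  dif_neg h.not_gt

lemma coord_val (x : EuclideanSpace ℝ (Fin d)) (i : Fin d) : coord x i = x i := dif_pos i.2

lemma ext_coord {x y : EuclideanSpace ℝ (Fin d)} (h : ∀ n < d, coord x n = coord y n) : x = y := by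
  ext i
  simpa only [coord_val] using h i i.2

lemma coord_zero (n : ℕ) : coord (0 : EuclideanSpace ℝ (Fin d)) n = 0 := by simp [coord]

lemma coord_add (x y : EuclideanSpace ℝ (Fin d)) (n : ℕ) :
    coord (x + y) n = coord x n + coord y n := by
  unfold coord
  split_ifs <;> simp

lemma coord_smul (a : ℝ) (x : EuclideanSpace ℝ (Fin d)) (n : ℕ) :
    coord (a • x) n = a * coord x n := by
  unfold coord
  split_ifs <;> simp

lemma coord_sub (x y : EuclideanSpace ℝ (Fin d)) (n : ℕ) :
    coord (x - y) n = coord x n - coord y n := by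
  unfold coord
  split_ifs <;> simp

lemma coord_toLp (F : ℕ → ℝ) {n : ℕ} (h : n < d) :
    coord (WithLp.toLp 2 fun i : Fin d => F i) n = F n := dif_pos h

lemma norm_sq_eq_sum_coord (x : EuclideanSpace ℝ (Fin d)) :
    ‖x‖ ^ 2 = ∑ n ∈ Finset.range d, coord x n ^ 2 := by
  simp only [EuclideanSpace.real_norm_sq_eq, Finset.sum_range, coord_val]

lemma sum_ite_val_eq_coord (x : EuclideanSpace ℝ (Fin d)) (n : ℕ) :
    ∑ j : Fin d, (if (j : ℕ) = n then x j else 0) = coord x n := by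
  by_cases h : n < d
  · simp [coord, h, ← Fin.ext_iff (b := ⟨n, h⟩)]
  · rw [coord_of_le x (not_lt.1 h)]
    exact Finset.sum_eq_zero fun j _ => if_neg (by lia)

/-- The coupling matrix as an operator on `ℝ^d`. -/
noncomputable def couplingCLM (d : ℕ) :
    EuclideanSpace ℝ (Fin d) →L[ℝ] EuclideanSpace ℝ (Fin d) :=
  Matrix.toEuclideanCLM (n := Fin d) (𝕜 := ℝ) (couplingMatrix d)

lemma couplingOp_apply (p : Polynomial ℝ) (x : EuclideanSpace ℝ (Fin d)) :
    couplingOp d p x = Polynomial.aeval (couplingCLM d) p x :=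
  congr($((Polynomial.aeval_algHom_apply
    (Matrix.toEuclideanCLM (n := Fin d) (𝕜 := ℝ)).toAlgEquiv.toAlgHom (couplingMatrix d) p).symm) x)

lemma isSelfAdjoint_couplingCLM : IsSelfAdjoint (couplingCLM d) := by
  have h : IsSelfAdjoint (couplingMatrix d) := by
    ext i j
    simp only [couplingMatrix, Matrix.star_apply, Matrix.of_apply, star_trivial,
      add_comm (j : ℕ)]
  exact h.map _

lemma coord_couplingCLM (x : EuclideanSpace ℝ (Fin d)) {n : ℕ} (hn : n < d) :
    coord (couplingCLM d x) n = coord x (d - 1 - n) - coord x (d - n) := by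
  rw [coord, dif_pos hn, ← sum_ite_val_eq_coord x, ← sum_ite_val_eq_coord x,
    ← Finset.sum_sub_distrib]
  change ∑ j, couplingMatrix d ⟨n, hn⟩ j * x j = _
  refine Finset.sum_congr rfl fun j _ => ?_
  have hdiag : n + (j : ℕ) + 1 = d ↔ (j : ℕ) = d - 1 - n := by lia
  have hbelow : n + (j : ℕ) = d ↔ (j : ℕ) = d - n := by lia
  simp only [couplingMatrix, Matrix.of_apply, hdiag, hbelow]
  split_ifs <;> first | lia | ring

lemma sum_coord_sub_sq_le (x : EuclideanSpace ℝ (Fin d)) :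
    ∑ n ∈ Finset.range d, coord x (d - n) ^ 2 ≤ ‖x‖ ^ 2 := by
  have hshift := Finset.sum_range_succ' (fun n => coord x n ^ 2) d
  rw [Finset.sum_range_succ, coord_of_le x le_rfl, ← norm_sq_eq_sum_coord] at hshift
  calc ∑ n ∈ Finset.range d, coord x (d - n) ^ 2
      = ∑ n ∈ Finset.range d, coord x (d - 1 - n + 1) ^ 2 :=
        Finset.sum_congr rfl fun n hn => by
          rw [show d - 1 - n + 1 = d - n by have := Finset.mem_range.1 hn; lia]
    _ = ∑ n ∈ Finset.range d, coord x (n + 1) ^ 2 :=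
        Finset.sum_range_reflect (fun n => coord x (n + 1) ^ 2) d
    _ ≤ ‖x‖ ^ 2 := by linarith [sq_nonneg (coord x 0)]

lemma norm_couplingCLM_le : ‖couplingCLM d‖ ≤ 2 := by
  refine ContinuousLinearMap.opNorm_le_bound _ zero_le_two fun x => ?_
  refine le_of_sq_le_sq ?_ (by positivity)
  calc ‖couplingCLM d x‖ ^ 2
      = ∑ n ∈ Finset.range d, (coord x (d - 1 - n) - coord x (d - n)) ^ 2 := by
        rw [norm_sq_eq_sum_coord]
        exact Finset.sum_congr rfl fun n hn => by
          rw [coord_couplingCLM x (Finset.mem_range.1 hn)]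
    _ ≤ ∑ n ∈ Finset.range d, 2 * (coord x (d - 1 - n) ^ 2 + coord x (d - n) ^ 2) :=
        Finset.sum_le_sum fun n _ => by
          linarith [sq_nonneg (coord x (d - 1 - n) + coord x (d - n))]
    _ ≤ (2 * ‖x‖) ^ 2 := by
        rw [← Finset.mul_sum, Finset.sum_add_distrib,
          Finset.sum_range_reflect (fun n => coord x n ^ 2) d, ← norm_sq_eq_sum_coord]
        linarith [sum_coord_sub_sq_le x]

lemma coord_couplingCLM_sq_zero (x : EuclideanSpace ℝ (Fin d)) (hd : 0 < d) :
    coord (couplingCLM d (couplingCLM d x)) 0 = coord x 0 - coord x 1 := by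
  rw [coord_couplingCLM _ hd, coord_couplingCLM _ (by lia), coord_of_le _ (d - 0).le_refl,
    show d - 1 - (d - 1 - 0) = 0 by lia, show d - (d - 1 - 0) = 1 by lia, sub_zero]

lemma coord_couplingCLM_sq_succ (x : EuclideanSpace ℝ (Fin d)) {n : ℕ} (hn : n + 1 < d) :
    coord (couplingCLM d (couplingCLM d x)) (n + 1) =
      2 * coord x (n + 1) - coord x (n + 2) - coord x n := by
  rw [coord_couplingCLM _ hn, coord_couplingCLM _ (by lia), coord_couplingCLM _ (by lia),
    show d - 1 - (d - 1 - (n + 1)) = n + 1 by lia, show d - (d - 1 - (n + 1)) = n + 2 by lia,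
    show d - 1 - (d - (n + 1)) = n by lia, show d - (d - (n + 1)) = n + 1 by lia]
  ring

/-- The vectors supported on the first `m` coordinates. -/
noncomputable def firstCoords (d m : ℕ) : Submodule ℝ (EuclideanSpace ℝ (Fin d)) where
  carrier := {x | ∀ n, m ≤ n → coord x n = 0}
  add_mem' hx hy n hn := by rw [coord_add, hx n hn, hy n hn, add_zero]
  zero_mem' n _ := coord_zero n
  smul_mem' a x hx n hn := by rw [coord_smul, hx n hn, mul_zero]

lemma firstCoords_mono : Monotone (firstCoords d) := fun _ _ h _ hx n hn => hx n (h.trans hn)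

lemma couplingCLM_sq_mem_firstCoords {m : ℕ} {x : EuclideanSpace ℝ (Fin d)}
    (hx : x ∈ firstCoords d m) : couplingCLM d (couplingCLM d x) ∈ firstCoords d (m + 1) := by
  intro n hn
  obtain ⟨k, rfl⟩ : ∃ k, n = k + 1 := ⟨n - 1, by lia⟩
  by_cases h : k + 1 < d
  · rw [coord_couplingCLM_sq_succ x h, hx _ (by lia), hx _ (by lia), hx _ (by lia)]
    ring
  · exact coord_of_le _ (not_lt.1 h)

lemma sqOp_couplingCLM_mem_firstCoords (a c : ℝ) {m : ℕ} {x : EuclideanSpace ℝ (Fin d)}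
    (hx : x ∈ firstCoords d m) : sqOp (couplingCLM d) a c x ∈ firstCoords d (m + 1) := by
  rw [sqOp_apply]
  exact add_mem (Submodule.smul_mem _ _ (couplingCLM_sq_mem_firstCoords hx))
    (Submodule.smul_mem _ _ (firstCoords_mono m.le_succ hx))

lemma couplingCLM_sqOp (a c : ℝ) (x : EuclideanSpace ℝ (Fin d)) :
    couplingCLM d (sqOp (couplingCLM d) a c x) = sqOp (couplingCLM d) a c (couplingCLM d x) := by
  simp only [sqOp_apply, map_add, map_smul]

/-- The vector with all entries `1`. -/
noncomputable def onesVec (d : ℕ) : EuclideanSpace ℝ (Fin d) := WithLp.toLp 2 fun _ => 1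

lemma coord_couplingCLM_onesVec {n : ℕ} (hn : n < d) :
    coord (couplingCLM d (onesVec d)) n = if n = 0 then 1 else 0 := by
  have hones : ∀ k < d, coord (onesVec d) k = 1 := fun k hk => coord_toLp (fun _ => 1) hk
  rw [coord_couplingCLM _ hn, hones _ (by lia)]
  split_ifs with hn₀
  · rw [coord_of_le _ (by lia), sub_zero]
  · rw [hones _ (by lia), sub_self]

lemma couplingCLM_onesVec_mem_firstCoords : couplingCLM d (onesVec d) ∈ firstCoords d 1 := by
  intro n hn
  by_cases h : n < d
  · rw [coord_couplingCLM_onesVec h, if_neg (by lia)]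
  · exact coord_of_le _ (not_lt.1 h)

end CouplingMatrix

section DecayVector

variable {d n N : ℕ} {r s : ℝ}

/-- The solution of `(Z² + s) x = ω e₁` for the coupling matrix `Z` and `(1 - r)² = s r`, up to a
factor. The reflected term makes the entry with index `d` vanish. -/
noncomputable def decayVec (d : ℕ) (r : ℝ) : EuclideanSpace ℝ (Fin d) :=
  WithLp.toLp 2 fun i => r ^ ((i : ℕ) + 1) - r ^ (2 * d + 1 - (i : ℕ))

lemma coord_decayVec (r : ℝ) (hn : n ≤ d) :
    coord (decayVec d r) n = r ^ (n + 1) - r ^ (2 * d + 1 - n) := by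
  rcases hn.eq_or_lt with rfl | hn
  · rw [coord_of_le _ le_rfl, show 2 * n + 1 - n = n + 1 by lia, sub_self]
  · exact coord_toLp (fun n => r ^ (n + 1) - r ^ (2 * d + 1 - n)) hn

lemma sqOp_decayVec (hrs : (1 - r) ^ 2 = s * r) (hd : 0 < d) :
    sqOp (couplingCLM d) 1 s (decayVec d r) =
      ((1 - r) * (1 + r ^ (2 * d + 1))) • couplingCLM d (onesVec d) := by
  refine ext_coord fun n hn => ?_
  rw [sqOp_apply, coord_add, coord_smul, coord_smul, coord_smul, coord_couplingCLM_onesVec hn]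
  rcases n with _ | n
  · rw [coord_couplingCLM_sq_zero _ hd, coord_decayVec r d.zero_le, coord_decayVec r hd,
      show 2 * d + 1 - 1 = 2 * d by lia, if_pos rfl]
    simp only [Nat.sub_zero, pow_succ, pow_zero]
    linear_combination (r ^ (2 * d) - 1) * hrs
  · rw [coord_couplingCLM_sq_succ _ hn, coord_decayVec r (by lia), coord_decayVec r (by lia),
      coord_decayVec r (by lia)]
    obtain ⟨e, he⟩ : ∃ e, 2 * d + 1 - (n + 2) = e := ⟨_, rfl⟩
    rw [he, show 2 * d + 1 - (n + 1) = e + 1 by lia, show 2 * d + 1 - n = e + 2 by lia]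
    simp only [pow_succ, Nat.add_eq_zero_iff, one_ne_zero, and_false, if_false]
    linear_combination (r ^ e - r ^ n * r) * hrs

variable (hr₀ : 0 < r) (hr₁ : r < 1)
include hr₀ hr₁

lemma decayVec_ne_zero (hd : 0 < d) : decayVec d r ≠ 0 := by
  intro h
  have hcoord := coord_decayVec (d := d) r d.zero_le
  have hlt : r ^ (2 * d + 1 - 0) < r ^ (0 + 1) := pow_lt_pow_right_of_lt_one₀ hr₀ hr₁ (by lia)
  rw [h, coord_zero] at hcoord
  linarith

lemma coord_decayVec_nonneg (hn : n ≤ d) : 0 ≤ coord (decayVec d r) n := by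
  rw [coord_decayVec r hn]
  exact sub_nonneg.2 (pow_le_pow_of_le_one hr₀.le hr₁.le (by lia))

lemma coord_decayVec_le_two_mul {i j : ℕ} (hi : i ≤ d) (hj : j ≤ n) (hd : d ≤ 2 * n)
    (hji : 2 * j ≤ i) : coord (decayVec d r) i ≤ 2 * coord (decayVec n r) j := by
  obtain ⟨m, rfl⟩ := Nat.exists_eq_add_of_le hj
  have hpow : r ^ (4 * (j + m) + 1 - 2 * j) ≤ r ^ (2 * d + 1 - i) :=
    pow_le_pow_of_le_one hr₀.le hr₁.le (by lia)
  have hrj : r ^ j ≤ 1 := pow_le_one₀ hr₀.le hr₁.le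
  have hrm : r ^ (2 * m) ≤ 1 := pow_le_one₀ hr₀.le hr₁.le
  calc coord (decayVec d r) i = r ^ (i + 1) - r ^ (2 * d + 1 - i) := coord_decayVec r hi
    _ ≤ r ^ (2 * j + 1) - r ^ (4 * (j + m) + 1 - 2 * j) :=
      sub_le_sub (pow_le_pow_of_le_one hr₀.le hr₁.le (by lia)) hpow
    _ = r ^ j * (1 + r ^ (2 * m)) * (r ^ (j + 1) * (1 - r ^ (2 * m))) := by
      rw [show 4 * (j + m) + 1 - 2 * j = 2 * j + 4 * m + 1 by lia]
      ring
    _ ≤ 2 * (r ^ (j + 1) * (1 - r ^ (2 * m))) := by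
      have := sub_nonneg.2 hrm
      gcongr
      linarith [mul_le_mul hrj (add_le_add_right hrm 1) (by positivity) zero_le_one]
    _ = 2 * coord (decayVec (j + m) r) j := by
      rw [coord_decayVec r hj, show 2 * (j + m) + 1 - j = j + 1 + 2 * m by lia]
      ring

lemma norm_decayVec_sq_le (hd : d ≤ 2 * n) : ‖decayVec d r‖ ^ 2 ≤ 8 * ‖decayVec n r‖ ^ 2 := by
  have hpairs : ∀ (F : ℕ → ℝ) (m : ℕ), ∑ i ∈ Finset.range (2 * m), F (i / 2) =
      ∑ j ∈ Finset.range m, 2 * F j := by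
    intro F m
    induction m with
    | zero => rfl
    | succ m ih =>
      rw [Nat.mul_succ, Finset.sum_range_succ, Finset.sum_range_succ, ih, Finset.sum_range_succ,
        show 2 * m / 2 = m by lia, show (2 * m + 1) / 2 = m by lia]
      ring
  calc ‖decayVec d r‖ ^ 2 = ∑ i ∈ Finset.range d, coord (decayVec d r) i ^ 2 :=
        norm_sq_eq_sum_coord _
    _ ≤ ∑ i ∈ Finset.range d, (2 * coord (decayVec n r) (i / 2)) ^ 2 := by
        refine Finset.sum_le_sum fun i hi => ?_
        have hi := (Finset.mem_range.1 hi).le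
        exact pow_le_pow_left₀ (coord_decayVec_nonneg hr₀ hr₁ hi)
          (coord_decayVec_le_two_mul hr₀ hr₁ hi (by lia) hd (by lia)) 2
    _ ≤ ∑ i ∈ Finset.range (2 * n), (2 * coord (decayVec n r) (i / 2)) ^ 2 :=
        Finset.sum_le_sum_of_subset_of_nonneg (Finset.range_mono hd) fun _ _ _ => sq_nonneg _
    _ = 8 * ‖decayVec n r‖ ^ 2 := by
        rw [hpairs (fun j => (2 * coord (decayVec n r) j) ^ 2), norm_sq_eq_sum_coord,
          Finset.mul_sum]
        exact Finset.sum_congr rfl fun j _ => by ring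

omit hr₀ hr₁ in
lemma norm_decayVec_tail_sq_le (hN : N ≤ d) {x : EuclideanSpace ℝ (Fin d)}
    (hx : x ∈ firstCoords d N) (κ : ℝ) :
    (κ * r ^ N) ^ 2 * ‖decayVec (d - N) r‖ ^ 2 ≤ ‖x - κ • decayVec d r‖ ^ 2 := by
  obtain ⟨n, rfl⟩ := Nat.exists_eq_add_of_le hN
  rw [norm_sq_eq_sum_coord, norm_sq_eq_sum_coord, Finset.sum_range_add, Nat.add_sub_cancel_left,
    Finset.mul_sum]
  refine le_add_of_nonneg_of_le (Finset.sum_nonneg fun _ _ => sq_nonneg _)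
    (Finset.sum_le_sum fun i hi => le_of_eq ?_)
  have hi := (Finset.mem_range.1 hi).le
  rw [coord_sub, coord_smul, hx _ (by lia), coord_decayVec r hi, coord_decayVec r (by lia),
    show 2 * (N + n) + 1 - (N + i) = N + (2 * n + 1 - i) by lia]
  ring

lemma pow_mul_norm_smul_decayVec_sq_le (hN : 2 * N ≤ d) {x : EuclideanSpace ℝ (Fin d)}
    (hx : x ∈ firstCoords d N) (κ : ℝ) :
    r ^ (2 * N) * ‖κ • decayVec d r‖ ^ 2 ≤ 8 * ‖x - κ • decayVec d r‖ ^ 2 := by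
  calc r ^ (2 * N) * ‖κ • decayVec d r‖ ^ 2 = (κ * r ^ N) ^ 2 * ‖decayVec d r‖ ^ 2 := by
        rw [norm_smul, mul_pow, Real.norm_eq_abs, sq_abs]
        ring
    _ ≤ (κ * r ^ N) ^ 2 * (8 * ‖decayVec (d - N) r‖ ^ 2) := by
        gcongr
        exact norm_decayVec_sq_le hr₀ hr₁ (by lia)
    _ ≤ 8 * ‖x - κ • decayVec d r‖ ^ 2 := by
        linarith [norm_decayVec_tail_sq_le (r := r) (show N ≤ d by lia) hx κ]

end DecayVector

section DecayRate

variable {r s ξ : ℝ}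

/-- The root in `(0, 1)` of `(1 - r)² = s r`. -/
noncomputable def decayRate (s : ℝ) : ℝ := Real.exp (-(2 * Real.arsinh (√s / 2)))

lemma decayRate_pos (s : ℝ) : 0 < decayRate s := Real.exp_pos _

lemma decayRate_lt_one (hs : 0 < s) : decayRate s < 1 := by
  have := Real.arsinh_pos_iff.2 (half_pos (Real.sqrt_pos.2 hs))
  exact Real.exp_lt_one_iff.2 (by linarith)

lemma one_sub_decayRate_sq (hs : 0 ≤ s) : (1 - decayRate s) ^ 2 = s * decayRate s := by
  obtain ⟨t, ht⟩ : ∃ t, Real.arsinh (√s / 2) = t := ⟨_, rfl⟩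
  have hsinh : Real.exp t - Real.exp (-t) = √s := by
    have := Real.sinh_arsinh (√s / 2)
    rw [ht, Real.sinh_eq] at this
    linarith
  have hexp : Real.exp t * Real.exp (-t) = 1 := by
    rw [← Real.exp_add, add_neg_cancel, Real.exp_zero]
  have hr : decayRate s = Real.exp (-t) ^ 2 := by
    rw [decayRate, ht, ← Real.exp_nat_mul]
    congr 1
    push_cast
    ring
  calc (1 - decayRate s) ^ 2 = ((Real.exp t - Real.exp (-t)) * Real.exp (-t)) ^ 2 := by
        rw [hr, sub_mul, hexp, sq (Real.exp (-t))]
    _ = s * decayRate s := by rw [hsinh, mul_pow, Real.sq_sqrt hs, hr]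

lemma neg_log_decayRate_le (s : ℝ) : -Real.log (decayRate s) ≤ √s := by
  have hsinh := Real.self_le_sinh_iff.2 (Real.arsinh_nonneg_iff.2 (by positivity : 0 ≤ √s / 2))
  rw [Real.sinh_arsinh] at hsinh
  rw [decayRate, Real.log_exp]
  linarith

lemma lt_decayRate (hs : 0 < s) (hsξ : s * ξ < 1) :
    1 - (1 / 2 + √(ξ + 1 / 4))⁻¹ < decayRate s := by
  have hr₀ := decayRate_pos s
  have hr₁ := sub_pos.2 (decayRate_lt_one hs)
  have hrs := one_sub_decayRate_sq hs.le
  set r := decayRate s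
  have hsqrt : √(ξ + 1 / 4) < (1 + r) / (2 * (1 - r)) := by
    refine (Real.sqrt_lt' (by positivity)).2 ?_
    rw [div_pow, lt_div_iff₀ (by positivity)]
    calc (ξ + 1 / 4) * (2 * (1 - r)) ^ 2 = 4 * r * (s * ξ) + (1 - r) ^ 2 := by
          linear_combination 4 * ξ * hrs
      _ < 4 * r * 1 + (1 - r) ^ 2 := by gcongr
      _ = (1 + r) ^ 2 := by ring
  have hinv : 1 - r < (1 / 2 + √(ξ + 1 / 4))⁻¹ := by
    rw [← one_div, lt_div_iff₀ (by positivity)]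
    rw [lt_div_iff₀ (by positivity)] at hsqrt
    linarith
  linarith

end DecayRate

namespace BilevelConstants

variable (P : BilevelConstants)

/-- The rate at which the entries of the minimiser of the hard instance decay. -/
noncomputable def r : ℝ := decayRate P.s

/-- The effective condition number of the hard instance. -/
noncomputable def ξ : ℝ := P.l / (2 * P.c)

lemma r_pos : 0 < P.r := decayRate_pos _

lemma r_lt_one : P.r < 1 := decayRate_lt_one P.s_pos

lemma one_sub_r_sq : (1 - P.r) ^ 2 = P.s * P.r := one_sub_decayRate_sq P.s_pos.le

lemma lt_r : 1 - (1 / 2 + √(P.ξ + 1 / 4))⁻¹ < P.r := lt_decayRate P.s_pos P.s_mul_l_lt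

lemma ξ_eq : P.ξ = P.Lgy / (4 * P.μy) + P.Lx / (8 * P.μx) +
    P.Ly * P.Lgxy ^ 2 / (8 * P.μx * P.μy ^ 2) - 3 / 8 := by
  have := P.μx_pos.ne'
  have := P.μy_pos.ne'
  simp only [ξ, l, c, α, β]
  field_simp
  ring

lemma le_ξ : P.Ly * P.Lgxy ^ 2 / 8 / P.c ≤ P.ξ := by
  have hμy := P.μy_pos
  have hα := P.α_nonneg
  have hβ := P.β_nonneg
  have hμx := P.μx_pos
  have hc := P.c_pos
  rw [ξ, div_div, div_le_div_iff₀ (by positivity) (by positivity), l]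
  have : 0 ≤ P.c * (P.α * P.μy ^ 2 + 2 * P.β * P.μx * P.μy) := by positivity
  linarith

variable (d : ℕ) (B : ℝ)

/-- The minimiser of the total objective of the hard instance in dimension `d`. -/
noncomputable def minimizer : EuclideanSpace ℝ (Fin d) := (B / ‖decayVec d P.r‖) • decayVec d P.r

/-- The linear term of the lower objective for which `P.minimizer d B` is the minimiser of the total
objective. -/
noncomputable def linearTerm : EuclideanSpace ℝ (Fin d) :=
  -(2 * (B / ‖decayVec d P.r‖ * ((1 - P.r) * (1 + P.r ^ (2 * d + 1)))) / (P.Ly * P.Lgxy)) •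
    sqOp (couplingCLM d) P.q P.k (onesVec d)

variable {P d B}

lemma norm_minimizer (hd : 0 < d) (hB : 0 ≤ B) : ‖P.minimizer d B‖ = B := by
  have hne := norm_ne_zero_iff.2 (decayVec_ne_zero P.r_pos P.r_lt_one hd)
  rw [minimizer, norm_smul, Real.norm_of_nonneg (by positivity), div_mul_cancel₀ _ hne]

lemma sqOp_minimizer_add_linearTerm (hd : 0 < d) :
    sqOp (couplingCLM d) P.q P.k (sqOp (couplingCLM d) 1 P.s (P.minimizer d B)) +
      (P.Ly * P.Lgxy / 2) • couplingCLM d (P.linearTerm d B) = 0 := by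
  have hLy := P.Ly_pos.ne'
  have hL := P.Lgxy_pos.ne'
  rw [minimizer, linearTerm, map_smul, sqOp_decayVec P.one_sub_r_sq hd,
    smul_smul, map_smul, map_smul, couplingCLM_sqOp, smul_smul, ← add_smul]
  convert zero_smul ℝ _
  field_simp
  ring

lemma couplingCLM_linearTerm_mem_firstCoords :
    couplingCLM d (P.linearTerm d B) ∈ firstCoords d 2 := by
  rw [linearTerm, map_smul, couplingCLM_sqOp]
  exact Submodule.smul_mem _ _
    (sqOp_couplingCLM_mem_firstCoords _ _ couplingCLM_onesVec_mem_firstCoords)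

lemma isCoupledQuadratic (b : EuclideanSpace ℝ (Fin d)) :
    IsCoupledQuadratic (P.upper (couplingCLM d) b) (P.lower (couplingCLM d) b) := by
  open Polynomial in
  refine ⟨C P.α * X ^ 2 + C P.μx, C (P.α * P.β / P.Lgxy) * X ^ 3, C P.Ly, C P.β * X ^ 2 + C P.μy,
    C (P.Lgxy / 2) * X, 0, -(2 * P.α * P.β / P.Lgxy ^ 2) • couplingCLM d (couplingCLM d b), b,
    fun x y => ?_, fun x y => ?_⟩ <;>
  simp [couplingOp_apply, upper, lower, quadUpper, quadLower, sqOp,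
    Algebra.algebraMap_eq_smul_one]

/-- The `y`-iterates lie in the preimages of the spaces `firstCoords d m` under `Z`: the coupling
matrix itself reverses the order of the coordinates, and only `Z²` maps each of these spaces into
the next one. -/
lemma outputSpace_le {b : EuclideanSpace ℝ (Fin d)} (hb : couplingCLM d b ∈ firstCoords d 2)
    (S : AlgorithmSchedule) :
    S.outputSpace (P.upper (couplingCLM d) b) (P.lower (couplingCLM d) b) ≤
      firstCoords d (S.M - 1) := by
  have hZ := isSelfAdjoint_couplingCLM (d := d)
  have hsmul {m : ℕ} (a : ℝ) {x} (hx : x ∈ firstCoords d m) : a • x ∈ firstCoords d m :=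
    Submodule.smul_mem _ a hx
  have hcube (x) : ((P.α * P.β / P.Lgxy) • couplingCLM d ^ 3) x =
    (P.α * P.β / P.Lgxy) • couplingCLM d (couplingCLM d (couplingCLM d x)) := rfl
  have hcube_adj : ((P.α * P.β / P.Lgxy) • couplingCLM d ^ 3).adjoint =
    (P.α * P.β / P.Lgxy) • couplingCLM d ^ 3 := ((IsSelfAdjoint.all _).smul (hZ.pow 3)).adjoint_eq
  have hJ_adj : ((P.Lgxy / 2) • couplingCLM d).adjoint = (P.Lgxy / 2) • couplingCLM d :=
    ((IsSelfAdjoint.all _).smul hZ).adjoint_eq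
  rw [show S.M - 1 = S.M - 2 + 1 by rw [AlgorithmSchedule.M]; lia]
  refine outputSpace_quad_le (PX := fun m => firstCoords d (m + 1))
    (PY := fun m => (firstCoords d (m + 1)).comap (couplingCLM d).toLinearMap)
    (fun _ _ h => firstCoords_mono (by lia))
    (fun _ _ h => Submodule.comap_mono (firstCoords_mono (by lia)))
    (isSelfAdjoint_sqOp hZ _ _) ((IsSelfAdjoint.all _).smul (.one _)) (isSelfAdjoint_sqOp hZ _ _)
    (fun m x hx => sqOp_couplingCLM_mem_firstCoords _ _ hx)
    (fun m y hy => hsmul _ (couplingCLM_sq_mem_firstCoords hy)) (fun m x hx => ?_)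
    (fun m y hy => ?_) (fun m y hy => ?_) (fun m y hy => hsmul _ hy) (fun m x hx => ?_)
    (zero_mem _) ?_ hb S <;>
  simp only [SetLike.mem_coe, Submodule.mem_comap, ContinuousLinearMap.coe_coe, hcube_adj, hJ_adj,
    hcube, map_smul, smul_apply, couplingCLM_sqOp]
  · exact hsmul _ (couplingCLM_sq_mem_firstCoords (couplingCLM_sq_mem_firstCoords hx))
  · exact hsmul _ (firstCoords_mono (by lia) hy)
  · exact sqOp_couplingCLM_mem_firstCoords _ _ hy
  · exact hsmul _ (couplingCLM_sq_mem_firstCoords hx)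
  · exact hsmul _ (couplingCLM_sq_mem_firstCoords hb)

end BilevelConstants

section Constants

/-- The factor lost in the lower bound for the optimality gap of the outputs, relative to the gap at
the starting point. -/
noncomputable def rateConst (Lx Ly Lgxy Lgy : ℝ) : ℝ := 1 / (8 * (Lx * Lgy ^ 2 + Ly * Lgxy ^ 2))

/-- The relative accuracy below which the constant factors in the lower bound for the optimality gap
do not affect the order of the number of iterations. -/
noncomputable def accuracyConst (Lx Ly Lgxy Lgy : ℝ) : ℝ :=
  Real.exp (-(2 * (|Real.log (rateConst Lx Ly Lgxy Lgy)| +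
    12 / √(Ly * Lgxy ^ 2 / (Lx * Lgy ^ 2)))))

lemma mul_log_le_of_mul_pow_le {r σ σ₀ a X : ℝ} {M : ℕ} (hr : 0 < r) (hσ₀ : 0 < σ₀) (hσ : σ₀ ≤ σ)
    (hrσ : -Real.log r * σ ≤ 3) (hr₁ : r < 1) (ha : 0 < a) (hX : 0 < X)
    (hXa : 2 * (|Real.log a| + 12 / σ₀) ≤ Real.log X) (hM : 2 ≤ M) (h : a * X * r ^ (2 * M) ≤ 1) :
    σ * Real.log X / 12 ≤ M - 2 := by
  have hM' : (0 : ℝ) ≤ M - 2 := sub_nonneg.2 (by exact_mod_cast hM)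
  have hlog : Real.log a + Real.log X ≤ 2 * M * -Real.log r := by
    have := Real.log_nonpos (by positivity) h
    rw [Real.log_mul (by positivity) (by positivity), Real.log_mul ha.ne' hX.ne', Real.log_pow]
      at this
    push_cast at this
    linarith
  have hθ : -Real.log r ≤ 12 / σ₀ / 4 := by
    have := neg_pos.2 (Real.log_neg hr hr₁)
    rw [div_div, le_div_iff₀ (by positivity)]
    linarith [mul_le_mul_of_nonneg_left hσ this.le]
  have hhalf : Real.log X / 2 ≤ 2 * (M - 2) * -Real.log r := by
    linarith [neg_abs_le (Real.log a)]
  calc σ * Real.log X / 12 = σ * (Real.log X / 2) / 6 := by ring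
    _ ≤ σ * (2 * (M - 2) * -Real.log r) / 6 := by
      have := hσ₀.le.trans hσ
      gcongr
    _ = (M - 2) * (-Real.log r * σ) / 3 := by ring
    _ ≤ (M - 2) * 3 / 3 := by gcongr
    _ = M - 2 := by ring

end Constants

lemma AlgorithmSchedule.two_le_M (S : AlgorithmSchedule) : 2 ≤ S.M := Nat.le_add_left _ _

lemma AlgorithmSchedule.le_complexity (S : AlgorithmSchedule) (τ : ℝ) :
    min τ 1 * ((S.M : ℝ) - 2) ≤ S.complexity τ := by
  have hM : (S.M : ℝ) - 2 = (S.Q + S.Q * S.T) + S.K := by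
    rw [AlgorithmSchedule.M]
    push_cast
    ring
  rw [hM, mul_add, AlgorithmSchedule.complexity]
  gcongr
  · exact min_le_left _ _
  · exact mul_le_of_le_one_left S.K.cast_nonneg (min_le_right _ _)

namespace BilevelConstants

variable (P : BilevelConstants)

/-- The square root of the condition number in the complexity bound. -/
noncomputable def σ : ℝ := √(P.Ly * P.Lgxy ^ 2 / P.c)

lemma σ_pos : 0 < P.σ :=
  Real.sqrt_pos.2 (div_pos (mul_pos P.Ly_pos (pow_pos P.Lgxy_pos 2)) P.c_pos)

lemma neg_log_r_mul_σ_le : -Real.log P.r * P.σ ≤ 3 := by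
  have hs : P.s * (P.Ly * P.Lgxy ^ 2 / P.c) ≤ 3 ^ 2 := by
    calc P.s * (P.Ly * P.Lgxy ^ 2 / P.c) = 8 * (P.s * (P.Ly * P.Lgxy ^ 2 / 8 / P.c)) := by ring
      _ ≤ 8 * (P.s * P.ξ) := by
        have := P.s_pos
        gcongr
        exact P.le_ξ
      _ ≤ 3 ^ 2 := by
        have hsξ : P.s * P.ξ < 1 := P.s_mul_l_lt
        linarith
  calc -Real.log P.r * P.σ ≤ √P.s * P.σ :=
        mul_le_mul_of_nonneg_right (neg_log_decayRate_le _) P.σ_pos.le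
    _ = √(P.s * (P.Ly * P.Lgxy ^ 2 / P.c)) := (Real.sqrt_mul P.s_pos.le _).symm
    _ ≤ 3 := Real.sqrt_le_iff.2 ⟨by norm_num, hs⟩

lemma sqrt_le_σ : √(P.Ly * P.Lgxy ^ 2 / (P.Lx * P.Lgy ^ 2)) ≤ P.σ := by
  have := P.Ly_pos
  have := P.μy_pos
  refine Real.sqrt_le_sqrt (div_le_div_of_nonneg_left (by positivity) P.c_pos ?_)
  exact mul_le_mul P.μx_le (by gcongr; exact P.μy_le) (by positivity) (P.μx_pos.le.trans P.μx_le)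

variable (d : ℕ) (B : ℝ)

/-- The optimality gap of the total objective of the hard instance in dimension `d`. -/
noncomputable def gap (x : EuclideanSpace ℝ (Fin d)) : ℝ :=
  totalObjective (P.upper (couplingCLM d) (P.linearTerm d B))
      (P.lower (couplingCLM d) (P.linearTerm d B)) x -
    totalObjective (P.upper (couplingCLM d) (P.linearTerm d B))
      (P.lower (couplingCLM d) (P.linearTerm d B)) (P.minimizer d B)

/-- An upper bound for the initial optimality gap in every dimension. -/
noncomputable def initialGapBound : ℝ := (P.Lx + P.Ly * P.Lgxy ^ 2 / P.μy ^ 2) / 2 * B ^ 2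

/-- A dimension in which every algorithm that exhausts the coordinates is already slow enough for
the complexity bound at accuracy `ε`. -/
noncomputable def dimensionBound (ε : ℝ) : ℕ := ⌈2 * (P.σ * (P.c * P.initialGapBound B / ε) + 2)⌉₊

variable {P d B} (hd : 0 < d)
include hd

lemma gap_zero_pos (hB : 0 < B) : 0 < P.gap d B 0 := by
  have hle := le_totalObjective_sub isSelfAdjoint_couplingCLM
    (sqOp_minimizer_add_linearTerm (P := P) (B := B) hd) 0
  have := P.μx_pos
  rw [zero_sub, norm_neg, norm_minimizer hd hB.le] at hle
  exact lt_of_lt_of_le (by positivity) hle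

lemma gap_zero_le (hB : 0 ≤ B) : P.gap d B 0 ≤ P.initialGapBound B := by
  have hle := totalObjective_sub_le isSelfAdjoint_couplingCLM
    (sqOp_minimizer_add_linearTerm (P := P) (B := B) hd) norm_couplingCLM_le 0
  rwa [zero_sub, norm_neg, norm_minimizer hd hB] at hle

lemma μy_sq_mul_gap_zero_le (hB : 0 ≤ B) :
    P.μy ^ 2 * P.gap d B 0 ≤ (P.Lx * P.Lgy ^ 2 + P.Ly * P.Lgxy ^ 2) / 2 * B ^ 2 := by
  have hμy := P.μy_pos
  have hLx := P.μx_pos.trans_le P.μx_le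
  calc P.μy ^ 2 * P.gap d B 0 ≤ P.μy ^ 2 * P.initialGapBound B := by
        gcongr
        exact gap_zero_le hd hB
    _ = (P.Lx * P.μy ^ 2 + P.Ly * P.Lgxy ^ 2) / 2 * B ^ 2 := by
        unfold initialGapBound
        field_simp
    _ ≤ (P.Lx * P.Lgy ^ 2 + P.Ly * P.Lgxy ^ 2) / 2 * B ^ 2 := by
        gcongr
        exact P.μy_le

lemma rateConst_mul_le_gap (hB : 0 ≤ B) {S : AlgorithmSchedule} (hS : 2 * S.M ≤ d)
    {x : EuclideanSpace ℝ (Fin d)}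
    (hx : x ∈ S.outputSpace (P.upper (couplingCLM d) (P.linearTerm d B))
      (P.lower (couplingCLM d) (P.linearTerm d B))) :
    rateConst P.Lx P.Ly P.Lgxy P.Lgy * (P.c * P.gap d B 0 * P.r ^ (2 * S.M)) ≤ P.gap d B x := by
  have hμx := P.μx_pos
  have hLx := P.μx_pos.trans_le P.μx_le
  have hLgy := P.μy_pos.trans_le P.μy_le
  have hLy := P.Ly_pos
  have hr := P.r_pos
  have htail : P.r ^ (2 * (S.M - 1)) * B ^ 2 ≤ 8 * ‖x - P.minimizer d B‖ ^ 2 := by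
    have := pow_mul_norm_smul_decayVec_sq_le P.r_pos P.r_lt_one (by lia)
      (outputSpace_le couplingCLM_linearTerm_mem_firstCoords S hx) (B / ‖decayVec d P.r‖)
    rwa [← minimizer, norm_minimizer hd hB] at this
  calc rateConst P.Lx P.Ly P.Lgxy P.Lgy * (P.c * P.gap d B 0 * P.r ^ (2 * S.M))
      = rateConst P.Lx P.Ly P.Lgxy P.Lgy * P.μx * P.r ^ (2 * S.M) * (P.μy ^ 2 * P.gap d B 0) := by
        rw [c]
        ring
    _ ≤ rateConst P.Lx P.Ly P.Lgxy P.Lgy * P.μx * P.r ^ (2 * S.M) *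
        ((P.Lx * P.Lgy ^ 2 + P.Ly * P.Lgxy ^ 2) / 2 * B ^ 2) := by
        refine mul_le_mul_of_nonneg_left (μy_sq_mul_gap_zero_le hd hB) ?_
        unfold rateConst
        positivity
    _ = P.μx / 16 * (P.r ^ (2 * S.M) * B ^ 2) := by
        unfold rateConst
        field_simp
        ring
    _ ≤ P.μx / 16 * (P.r ^ (2 * (S.M - 1)) * B ^ 2) := by
        gcongr ?_ * (?_ * ?_)
        exact pow_le_pow_of_le_one hr.le P.r_lt_one.le (by lia)
    _ ≤ P.μx / 16 * (8 * ‖x - P.minimizer d B‖ ^ 2) := by gcongr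
    _ = P.μx / 2 * ‖x - P.minimizer d B‖ ^ 2 := by ring
    _ ≤ P.gap d B x := le_totalObjective_sub isSelfAdjoint_couplingCLM
        (sqOp_minimizer_add_linearTerm hd) x

lemma σ_mul_log_le (hB : 0 < B) {ε : ℝ} (hε : 0 < ε) (hdε : P.dimensionBound B ε ≤ d)
    (hεΔ : ε ≤ accuracyConst P.Lx P.Ly P.Lgxy P.Lgy * (P.c * P.gap d B 0)) {S : AlgorithmSchedule}
    {x : EuclideanSpace ℝ (Fin d)}
    (hx : x ∈ S.outputSpace (P.upper (couplingCLM d) (P.linearTerm d B))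
      (P.lower (couplingCLM d) (P.linearTerm d B))) (hgap : P.gap d B x ≤ ε) :
    P.σ * Real.log (P.c * P.gap d B 0 / ε) / 12 ≤ S.M - 2 := by
  have hc := P.c_pos
  have hσ := P.σ_pos
  have hLx := P.μx_pos.trans_le P.μx_le
  have hLgy := P.μy_pos.trans_le P.μy_le
  have hLy := P.Ly_pos
  have hLgxy := P.Lgxy_pos
  have hX : 0 < P.c * P.gap d B 0 / ε := div_pos (mul_pos hc (gap_zero_pos hd hB)) hε
  by_cases hS : 2 * S.M ≤ d
  · refine mul_log_le_of_mul_pow_le (a := rateConst P.Lx P.Ly P.Lgxy P.Lgy) P.r_pos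
      (by positivity) P.sqrt_le_σ P.neg_log_r_mul_σ_le P.r_lt_one
      (by unfold rateConst; positivity) hX ?_ S.two_le_M ?_
    · rw [Real.le_log_iff_exp_le hX, le_div_iff₀ hε, ← le_div_iff₀' (Real.exp_pos _),
        div_eq_inv_mul, ← Real.exp_neg]
      exact hεΔ
    · have := (rateConst_mul_le_gap hd hB.le hS hx).trans hgap
      rw [← div_le_one hε] at this
      exact this.trans_eq' (by ring)
  · have hdim : 2 * (P.σ * (P.c * P.initialGapBound B / ε) + 2) ≤ d :=
      (Nat.le_ceil _).trans (by exact_mod_cast hdε)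
    have hM : (d : ℝ) ≤ 2 * S.M := by exact_mod_cast (not_le.1 hS).le
    have hlog : P.σ * Real.log (P.c * P.gap d B 0 / ε) ≤
        P.σ * (P.c * P.initialGapBound B / ε) := by
      gcongr
      calc Real.log (P.c * P.gap d B 0 / ε) ≤ P.c * P.gap d B 0 / ε := Real.log_le_self hX.le
        _ ≤ P.c * P.initialGapBound B / ε := by
          gcongr
          exact gap_zero_le hd hB.le
    have hpos : (0 : ℝ) ≤ S.M - 2 := sub_nonneg.2 (by exact_mod_cast S.two_le_M)
    linarith

end BilevelConstants

theorem mainTheorem6_general (Lx Lxy Ly Lgxy Lgy τ : ℝ)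
    (hLx : 0 < Lx) (hLy : 0 < Ly) (hLgxy : 0 < Lgxy) (hLgy : 0 < Lgy) (hτ : 0 < τ) :
    ∃ c₁ c₃ c₄ c₅ : ℝ, 0 < c₁ ∧ 0 < c₃ ∧ 0 < c₄ ∧ 0 < c₅ ∧
      ∀ μx μy : ℝ, 0 < μx → μx ≤ Lx → 0 < μy → μy ≤ Lgy →
        (Lx - μx) * (Lgy - μy) / (2 * Lgxy) ≤ Lxy →
        ∃ r ξ : ℝ,
          Lgy / (4 * μy) + Lx / (8 * μx) + Ly * Lgxy ^ 2 / (8 * μx * μy ^ 2) - 3 / 8 ≤ ξ ∧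
          c₁ / (μx * μy ^ 2) ≤
            Lgy / (4 * μy) + Lx / (8 * μx) + Ly * Lgxy ^ 2 / (8 * μx * μy ^ 2) - 3 / 8 ∧
          1 - (1 / 2 + √(ξ + 1 / 4))⁻¹ < r ∧ r < 1 ∧
          ∀ ρxy ρyy B : ℝ, 0 ≤ ρxy → 0 ≤ ρyy → 0 < B →
            ∃ D : ℝ → ℕ, ∀ d : ℕ, 0 < d →
              ∃ (f g : EuclideanSpace ℝ (Fin d) → EuclideanSpace ℝ (Fin d) → ℝ)
                (xs : EuclideanSpace ℝ (Fin d)),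
                SCSCClass Lx Lxy Ly Lgxy Lgy ρxy ρyy μx μy B f g ∧
                IsCoupledQuadratic f g ∧
                IsMinOn (totalObjective f g) Set.univ xs ∧
                (∀ S : AlgorithmSchedule, 2 * S.M ≤ d → ∀ xK ∈ S.outputSpace f g,
                  c₃ * (μx * μy ^ 2 * (totalObjective f g 0 - totalObjective f g xs)
                      * r ^ (2 * S.M)) ≤
                    totalObjective f g xK - totalObjective f g xs) ∧
                (∀ ε : ℝ, 0 < ε → D ε ≤ d →
                  ε ≤ c₄ * (μx * μy ^ 2 * (totalObjective f g 0 - totalObjective f g xs)) →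
                  ∀ S : AlgorithmSchedule, ∀ xK ∈ S.outputSpace f g,
                    totalObjective f g xK - totalObjective f g xs ≤ ε →
                    c₅ * (√(Ly * Lgxy ^ 2 / (μx * μy ^ 2))
                        * Real.log (μx * μy ^ 2 *
                            (totalObjective f g 0 - totalObjective f g xs) / ε)) ≤
                      S.complexity τ) := by
  have := lt_min hτ one_pos
  refine ⟨Ly * Lgxy ^ 2 / 8, rateConst Lx Ly Lgxy Lgy, accuracyConst Lx Ly Lgxy Lgy, min τ 1 / 12,
    by positivity, by unfold rateConst; positivity, Real.exp_pos _, by positivity, ?_⟩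
  intro μx μy hμx hμx_le hμy hμy_le hLxy
  let P : BilevelConstants := ⟨Lx, Ly, Lgxy, Lgy, μx, μy, hLy, hLgxy, hμx, hμx_le, hμy, hμy_le⟩
  refine ⟨P.r, P.ξ, P.ξ_eq.ge, P.le_ξ.trans_eq P.ξ_eq, P.lt_r, P.r_lt_one, ?_⟩
  intro ρxy ρyy B hρxy hρyy hB
  refine ⟨P.dimensionBound B, fun d hd => ?_⟩
  have hZ := isSelfAdjoint_couplingCLM (d := d)
  have hxs := P.sqOp_minimizer_add_linearTerm (B := B) hd
  refine ⟨_, _, P.minimizer d B, ?_, P.isCoupledQuadratic _, P.isMinOn_totalObjective hZ hxs,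
    fun S hS xK hxK => P.rateConst_mul_le_gap hd hB.le hS hxK, fun ε hε hdε hεΔ S xK hxK hgap => ?_⟩
  · have hclass := P.scscClass hZ hxs norm_couplingCLM_le hLxy hρxy hρyy
    rwa [P.norm_minimizer hd hB.le] at hclass
  · calc _ = min τ 1 * (P.σ * Real.log (P.c * P.gap d B 0 / ε) / 12) := by
          rw [div_mul_eq_mul_div, mul_div_assoc]; rfl
      _ ≤ min τ 1 * (S.M - 2) := by gcongr; exact P.σ_mul_log_le hd hB hε hdε hεΔ hxK hgap
      _ ≤ S.complexity τ := S.le_complexity τ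

theorem mainTheorem6 (Lx Lxy Ly Lgxy Lgy τ : ℝ)
    (hLx : 0 < Lx) (hLy : 0 < Ly) (hLgxy : 0 < Lgxy) (hLgy : 0 < Lgy) (hτ : 0 < τ) :
    ∃ c₁ c₂ c₃ c₄ c₅ : ℝ, 0 < c₁ ∧ 0 < c₂ ∧ 0 < c₃ ∧ 0 < c₄ ∧ 0 < c₅ ∧
      ∀ μx μy : ℝ, 0 < μx → μx ≤ Lx → 0 < μy → μy ≤ Lgy →
        (Lx - μx) * (Lgy - μy) / (2 * Lgxy) ≤ Lxy →
        ∃ r ξ : ℝ,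
          Lgy / (4 * μy) + Lx / (8 * μx) + Ly * Lgxy ^ 2 / (8 * μx * μy ^ 2) - 3 / 8 ≤ ξ ∧
          c₁ / (μx * μy ^ 2) ≤
            Lgy / (4 * μy) + Lx / (8 * μx) + Ly * Lgxy ^ 2 / (8 * μx * μy ^ 2) - 3 / 8 ∧
          1 - (1 / 2 + Real.sqrt (ξ + 1 / 4))⁻¹ < r ∧ r < 1 ∧
          ∀ ρxy ρyy B : ℝ, 0 ≤ ρxy → 0 ≤ ρyy → 0 < B →
            ∃ D : ℝ → ℕ, ∀ d : ℕ, 5 ≤ d →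
              ∃ (f g : EuclideanSpace ℝ (Fin d) → EuclideanSpace ℝ (Fin d) → ℝ)
                (xs : EuclideanSpace ℝ (Fin d)),
                SCSCClass Lx Lxy Ly Lgxy Lgy ρxy ρyy μx μy B f g ∧
                IsCoupledQuadratic f g ∧
                IsMinOn (totalObjective f g) Set.univ xs ∧
                -- the convergence rate
                (∀ S : AlgorithmSchedule,
                  max (2 * (S.M : ℝ)) ((S.M : ℝ) + 1 + Real.logb r (c₂ * (μx * μy ^ 2))) < (d : ℝ) →
                  ∀ xK ∈ S.outputSpace f g,
                    c₃ * (μx * μy ^ 2 * (totalObjective f g 0 - totalObjective f g xs)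
                        * r ^ (2 * S.M)) ≤
                      totalObjective f g xK - totalObjective f g xs) ∧
                -- the complexity
                (∀ ε : ℝ, 0 < ε → D ε ≤ d →
                  ε ≤ c₄ * (μx * μy ^ 2 * (totalObjective f g 0 - totalObjective f g xs)) →
                  ∀ S : AlgorithmSchedule, ∀ xK ∈ S.outputSpace f g,
                    totalObjective f g xK - totalObjective f g xs ≤ ε →
                    c₅ * (Real.sqrt (Ly * Lgxy ^ 2 / (μx * μy ^ 2))
                        * Real.log (μx * μy ^ 2 *
                            (totalObjective f g 0 - totalObjective f g xs) / ε)) ≤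
                      S.complexity τ) := by
  obtain ⟨c₁, c₃, c₄, c₅, h₁, h₃, h₄, h₅, h⟩ :=
    mainTheorem6_general Lx Lxy Ly Lgxy Lgy τ hLx hLy hLgxy hLgy hτ
  refine ⟨c₁, 1, c₃, c₄, c₅, h₁, one_pos, h₃, h₄, h₅, fun μx μy hμx hμx' hμy hμy' hLxy => ?_⟩
  obtain ⟨r, ξ, hξ, hξ', hr, hr', h⟩ := h μx μy hμx hμx' hμy hμy' hLxy
  refine ⟨r, ξ, hξ, hξ', hr, hr', fun ρxy ρyy B hρxy hρyy hB => ?_⟩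
  obtain ⟨D, h⟩ := h ρxy ρyy B hρxy hρyy hB
  refine ⟨D, fun d hd => ?_⟩
  obtain ⟨f, g, xs, hclass, hquad, hmin, hrate, hcomplexity⟩ := h d (by lia)
  refine ⟨f, g, xs, hclass, hquad, hmin, fun S hS => hrate S ?_, hcomplexity⟩
  exact_mod_cast ((le_max_left _ _).trans_lt hS).le
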